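/- **Setting.** Let $\mathbb R^{n_1},\dots,\mathbb R^{n_B}$ and $\mathbb R^{\ell}$ be finite-dimensional real inner product spaces, let $\mathbb R^n=\mathbb R^{n_1}\times\cdots\times\mathbb R^{n_B}$ carry the product inner product, and write $x=(x_1,\dots,x_B)$, $x_{<t}=(x_1,\dots,x_{t-1})$, and similarly $x_{\le t},x_{>t}$. Consider $$\min_{x}\{\phi(x):=f(x)+h(x)\;:\;Ax=d\},\qquad h(x)=\sum_{t=1}^B h_t(x_t),\quad Ax=\sum_{t=1}^B A_tx_t ,$$ with linear operators $A_t:\mathbb R^{n_t}\to\mathbb R^\ell$ and $d\in\mathbb R^\ell$, under the following assumptions. * (A1) Each $h_t:\mathbb R^{n_t}\to(-\infty,\infty]$ is proper, convex and lower semicontinuous, and $\mathcal H_t:=\operatorname{dom}h_t$ is compact; put $\mathcal H:=\mathcal H_1\times\cdots\times\mathcal H_B$. * (A2) $A\ne0$ and $\mathcal F:=\{x\in\mathcal H:Ax=d\}\neq\emptyset$. * (A3) $h$ is $K_h$-Lipschitz on $\mathcal H$, with $K_h\ge0$. * (A4) For every $t$ there is $m_t\ge0$ such that $u\mapsto f(x_{<t},u,x_{>t})+\frac{m_t}{2}\|u\|^2$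 is convex on $\mathcal H_t$ for all $x\in\mathcal H$. * (A5) $f$ is differentiable on $\mathcal H$ with bounded gradient, and for every $t$ there is $M_t\ge 0$ with $\|\nabla_{x_t}f(x_{\le t},\tilde x_{>t})-\nabla_{x_t}f(x_{\le t},x_{>t})\|\le M_t\|\tilde x_{>t}-x_{>t}\|$ for all $x,\tilde x\in\mathcal H$ (for $t=B$ the condition is empty, and one may take $M_B=0$). * (A6) There is $z_\dagger\in\mathcal F$ with $d_\dagger:=\operatorname{dist}(z_\dagger,\partial\mathcal H)>0$. For $(\rho,\eta)\in\mathbb R_{++}^2$, a $(\rho,\eta)$-*stationary pair* is a pair $(\bar z,\bar q)\in\mathcal H\times\mathbb R^\ell$ with $\operatorname{dist}(0,\nabla f(\bar z)+A^*\bar q+\partial h(\bar z))\le\rho$ and $\|A\bar z-d\|\le\eta$. **Static DP.ADMM.** Let $\mathcal L_c^\theta(x;p)=\phi(x)+(1-\theta)\langle p,Ax-d\rangle+\frac c2\|Ax-d\|^2$, let $m=\max_tm_t$, $M=\max_tM_t$, let $(\chi,\theta)\in(0,1]^2$ satisfy $2\chi B(2-\theta)(1-\theta)\le\theta^2$, and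 let $\lambda>0$ with $2m\lambda\le1$. Given $x^0\in\mathcal H$, $p^0\in A(\mathbb R^n)$, $c>0$ and $(\rho,\eta)\in\mathbb R^2_{++}$, iteration $k=1,2,\dots$ does the following. 1. For $t=1,\dots,B$: $x_t^k=\operatorname{argmin}_{u}\{\lambda\mathcal L_c^\theta(x_{<t}^k,u,x_{>t}^{k-1};p^{k-1})+\frac12\|u-x_t^{k-1}\|^2\}$. Then $q^k=(1-\theta)p^{k-1}+c(Ax^k-d)$. 2. (a) Set $v_t^k=\nabla_{x_t}f(x^k)-\nabla_{x_t}f(x^k_{\le t},x^{k-1}_{>t})+cA_t^*\sum_{s>t}A_s(x_s^k-x_s^{k-1})-\frac1\lambda(x_t^k-x_t^{k-1})$ for each $t$. If $\|v^k\|\le\rho$ and $\|Ax^k-d\|\le\eta$, stop *successfully*. (b) Otherwise, if $k\ge3$ is even and $\frac1\rho\cdot\frac2{k+2}\sum_{i=k/2}^k\|v^i\|+\frac1\eta\sqrt{\frac{c^3}{k}}\cdot\frac2{k+2}\sum_{i=k/2}^k\|Ax^i-d\|\le1$, stop *unsuccessfully*. 3. Set $p^k=(1-\theta)p^{k-1}+\chi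 c(Ax^k-d)$. If it stops at iteration $k$, its output is $(x^k,p^k,q^k,v^k)$, with $p^k$ given by the formula of step 3. **Constants.** Let $D_\dagger=\sup_{z\in\mathcal H}\|z-z_\dagger\|$, $G_f=\sup_{\mathcal H}\|\nabla f\|$, $\Delta_\phi=\sup_{\mathcal H}\phi-\inf_{\mathcal H}\phi$, let $\sigma_A^+$ be the smallest positive singular value of $A$, $\|A\|$ the operator norm, $\|A\|_\dagger=\sum_t\|A_t\|$, and $$\kappa_0=\tfrac{2B^2(\lambda M+1)}{\sqrt\lambda},\quad \kappa_1=\tfrac{\chi\|A\|D_\dagger}{\theta},\quad \kappa_2=\tfrac1\theta\Big[1+\tfrac{2\chi D_\dagger(K_h+G_f)}{\theta d_\dagger\sigma_A^+}\Big]+1,\quad \kappa_3=\tfrac{108\kappa_2^2}{\chi^2},$$ $$\kappa_4=\tfrac{\theta d_\dagger\sigma_A^+}{\chi D_\dagger},\quad \kappa_5=8(B-1)\|A\|_\dagger^2,\quad \kappa_6=3+\tfrac{8\kappa_0^2\Delta_\phi}{\kappa_4^2},$$ $$\tilde\kappa^{(0)}_{\underline c}=2\Big(\sqrt{\Delta_\phi}+\tfrac{5\kappa_2}{\chi\sqrt{\underline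 c}}\Big),\quad \tilde\kappa^{(1)}_{\underline c}=3\kappa_0^2[\tilde\kappa^{(0)}_{\underline c}]^2,\quad \tilde\kappa^{(2)}_{\underline c}=3\kappa_5[\tilde\kappa^{(0)}_{\underline c}]^2,$$ $$\xi^{(0)}_{\mathcal R}=\tfrac{8}{\kappa_4^2}\Big[\tfrac{9\kappa_0^2(\mathcal R+\kappa_1)^2}{\chi^2}+\kappa_5\Delta_\phi\Big]+(1-\theta)(\mathcal R+\kappa_1),\quad \xi^{(1)}_{\mathcal R}=\tfrac{72\kappa_5(\mathcal R+\kappa_1)^2}{\chi^2\kappa_4^2},$$ $$\mathcal T_c(\rho,\eta\,|\,\underline c,\mathcal R)=48\Big(\Big\{\kappa_6+\tfrac{\tilde\kappa^{(1)}_{\underline c}}{\rho^2}\Big\}+\Big\{\xi^{(0)}_{\mathcal R}+\tfrac{\kappa_3}{\eta^2}+\tfrac{\tilde\kappa^{(2)}_{\underline c}}{\rho^2}\Big\}c+\xi^{(1)}_{\mathcal R}c^2\Big),$$ $$\hat c(\rho,\eta\,|\,\underline c,\mathcal R)=\frac1{\underline c^2}\Big[\mathcal T_{\underline c}(1,1\,|\,\underline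 c,\mathcal R)+\frac{\sqrt{\underline c^3\,\mathcal T_{\underline c}(1,1\,|\,\underline c,\mathcal R)}}{\min\{\rho,\eta\}}\Big].$$ **Proposition.** Let $\mathcal R\ge0$ and $\underline c>0$, and suppose $\|p^0\|\le c\mathcal R$ and $c\ge\underline c$. Then the iterates of static DP.ADMM are well defined (each argmin exists and is unique), and: (a) it stops after at most $\mathcal T_c(\rho,\eta\,|\,\underline c,\mathcal R)$ iterations; (b) if it stops successfully (step 2(a)), then the first and third components $(x^k,q^k)$ of its output form a $(\rho,\eta)$-stationary pair; (c) if $c\ge\hat c(\rho,\eta\,|\,\underline c,\mathcal R)$, then it stops successfully. Moreover, with the problem, $(m_t),(M_t),K_h,z_\dagger,\chi,\theta,\lambda,\underline c,\mathcal R$ fixed and $\varepsilon:=\min\{\rho,\eta\}$: $\mathcal T_c(\rho,\eta\,|\,\underline c,\mathcal R)=O(1+(1+\rho^{-2}+\eta^{-2})c+c^2)$ uniformly in $\rho,\eta>0$ and $c\ge\underline c$; $\hat c(\rho,\eta\,|\,\underline c,\mathcal R)=O(\varepsilon^{-1})$ uniformly for $\varepsilon\le1$; and for every constant $K$ there is a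 constant $C$ (also independent of $x^0,p^0$) such that, whenever $\varepsilon\le1$ and $\max\{\underline c,\hat c(\rho,\eta\,|\,\underline c,\mathcal R)\}\le c\le K\varepsilon^{-1}$ and $\|p^0\|\le c\mathcal R$, the method stops successfully, with a $(\rho,\eta)$-stationary pair, after at most $C\varepsilon^{-3}$ iterations. -/

import Mathlib

noncomputable section

namespace DPADMM

/-- Subdifferential of an extended-real-valued function on a real inner product space. -/
def subdiff {V : Type*} [NormedAddCommGroup V] [InnerProductSpace ℝ V]
    (g : V → EReal) (z : V) : Set V :=
  {u | ∀ z', g z + ((inner ℝ u (z' - z) : ℝ) : EReal) ≤ g z'}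

/-- Convexity of an extended-real-valued function, through its epigraph. -/
def EConvex {V : Type*} [NormedAddCommGroup V] [InnerProductSpace ℝ V] (g : V → EReal) : Prop :=
  Convex ℝ {w : V × ℝ | g w.1 ≤ (w.2 : EReal)}

/-- Data of the problem `min {f(x) + ∑ h_t(x_t) : ∑ A_t x_t = d}` with `B` blocks.
The space of `x = (x_1, …, x_B)` is the Euclidean product `PiLp 2 E` of the blocks. -/
structure Problem {B : ℕ} (E : Fin B → Type*) (Y : Type*)
    [∀ t, NormedAddCommGroup (E t)] [∀ t, InnerProductSpace ℝ (E t)]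
    [NormedAddCommGroup Y] [InnerProductSpace ℝ Y] where
  /-- smooth part of the objective; only its values on the domain of `h` matter -/
  f : PiLp 2 E → ℝ
  /-- block components of the nonsmooth part -/
  h : ∀ t, E t → EReal
  /-- block components of the constraint operator -/
  A : ∀ t, E t →L[ℝ] Y
  /-- right-hand side of the constraint -/
  d : Y

/-- The scalars and the Slater point that the assumptions on the problem provide:
weak convexity moduli `m_t`, Lipschitz moduli `M_t`, Lipschitz constant `K_h`, point `z_†`. -/
structure Moduli {B : ℕ} (E : Fin B → Type*) where
  m : Fin B → ℝ
  M : Fin B → ℝ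
  Kh : ℝ
  zdag : PiLp 2 E

/-- Under-relaxation parameter `χ`, dampening factor `θ`, prox stepsize `λ`. -/
structure Params where
  χ : ℝ
  θ : ℝ
  lam : ℝ

/-- The point `(x_{<t}, u, y_{>t})`. -/
def glue {B : ℕ} {E : Fin B → Type*} (t : Fin B) (x : PiLp 2 E) (u : E t) (y : PiLp 2 E) :
    PiLp 2 E :=
  WithLp.toLp 2 (Function.update (fun s => if s < t then x s else y s) t u)

/-- `‖x_{>t}‖`. -/
def normGT {B : ℕ} {E : Fin B → Type*} [∀ t, NormedAddCommGroup (E t)]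
    (t : Fin B) (x : PiLp 2 E) : ℝ :=
  Real.sqrt (∑ s ∈ Finset.Ioi t, ‖x s‖ ^ 2)

/-- `m = max_t m_t`. -/
def Moduli.mMax {B : ℕ} {E : Fin B → Type*} (W : Moduli E) : ℝ := ⨆ t, W.m t

/-- `M = max_t M_t`. -/
def Moduli.MMax {B : ℕ} {E : Fin B → Type*} (W : Moduli E) : ℝ := ⨆ t, W.M t

/-- `(χ,θ) ∈ (0,1]²`, `2χB(2-θ)(1-θ) ≤ θ²`, and `λ ∈ (0, 1/(2m)]`
(no upper bound on `λ` when `m = 0`). -/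
structure Params.Admissible (S : Params) (B : ℕ) (m : ℝ) : Prop where
  chi_pos : 0 < S.χ
  chi_le : S.χ ≤ 1
  theta_pos : 0 < S.θ
  theta_le : S.θ ≤ 1
  chi_theta : 2 * S.χ * B * (2 - S.θ) * (1 - S.θ) ≤ S.θ ^ 2
  lam_pos : 0 < S.lam
  lam_le : 2 * m * S.lam ≤ 1

namespace Problem

variable {B : ℕ} {E : Fin B → Type*} {Y : Type*}
  [∀ t, NormedAddCommGroup (E t)] [∀ t, InnerProductSpace ℝ (E t)]
  [NormedAddCommGroup Y] [InnerProductSpace ℝ Y]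

/-- `A x = ∑ A_t x_t`. -/
def opA (P : Problem E Y) : PiLp 2 E →L[ℝ] Y := ∑ t, (P.A t).comp (PiLp.proj 2 E t)

/-- `A x - d`. -/
def feas (P : Problem E Y) (x : PiLp 2 E) : Y := P.opA x - P.d

/-- `ℋ_t = dom h_t`. -/
def domBlock (P : Problem E Y) (t : Fin B) : Set (E t) := {u | P.h t u < ⊤}

/-- `ℋ = ℋ_1 × ⋯ × ℋ_B`. -/
def dom (P : Problem E Y) : Set (PiLp 2 E) := {x | ∀ t, x t ∈ P.domBlock t}

/-- `h(x) = ∑ h_t(x_t)`. -/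
def hSum (P : Problem E Y) (x : PiLp 2 E) : EReal := ∑ t, P.h t (x t)

/-- `φ = f + h`. -/
def phi (P : Problem E Y) (x : PiLp 2 E) : EReal := (P.f x : EReal) + P.hSum x

/-- The dampened augmented Lagrangian. -/
def lagr (P : Problem E Y) (θ c : ℝ) (x : PiLp 2 E) (p : Y) : EReal :=
  P.phi x + (((1 - θ) * inner ℝ p (P.feas x) + c / 2 * ‖P.feas x‖ ^ 2 : ℝ) : EReal)

variable [∀ t, FiniteDimensional ℝ (E t)] [FiniteDimensional ℝ Y]

/-- `∇f` on `ℋ`; the block `grad x t` is the partial gradient `∇_{x_t} f(x)`. -/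
def grad (P : Problem E Y) (x : PiLp 2 E) : PiLp 2 E := gradientWithin P.f P.dom x

/-- The standing assumptions. -/
structure Assumptions (P : Problem E Y) (W : Moduli E) : Prop where
  /-- each `h_t` takes values in `(-∞,∞]` and is proper, convex, lower semicontinuous,
  with compact domain -/
  h_ne_bot : ∀ t u, P.h t u ≠ ⊥
  h_proper : ∀ t, (P.domBlock t).Nonempty
  h_convex : ∀ t, EConvex (P.h t)
  h_lsc : ∀ t, LowerSemicontinuous (P.h t)
  h_compact : ∀ t, IsCompact (P.domBlock t)
  /-- `A ≢ 0` -/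
  A_ne : P.opA ≠ 0
  /-- `h` is `K_h`-Lipschitz on `ℋ` -/
  Kh_nonneg : 0 ≤ W.Kh
  h_lip : ∀ x ∈ P.dom, ∀ y ∈ P.dom, |(P.hSum x).toReal - (P.hSum y).toReal| ≤ W.Kh * ‖x - y‖
  /-- block-wise weak convexity of `f` -/
  m_nonneg : ∀ t, 0 ≤ W.m t
  f_weak : ∀ t, ∀ x ∈ P.dom,
    ConvexOn ℝ (P.domBlock t) (fun u => P.f (glue t x u x) + W.m t / 2 * ‖u‖ ^ 2)
  /-- `f` is differentiable on `ℋ` with bounded gradient, and each `∇_{x_t} f` is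
  `M_t`-Lipschitz in `x_{>t}` (for the last block this says nothing, since `x_{>B}` is empty) -/
  f_diff : DifferentiableOn ℝ P.f P.dom
  grad_bdd : BddAbove ((fun x => ‖P.grad x‖) '' P.dom)
  M_nonneg : ∀ t, 0 ≤ W.M t
  grad_lip : ∀ t, ∀ x ∈ P.dom, ∀ y ∈ P.dom,
    ‖P.grad (glue t x (x t) y) t - P.grad x t‖ ≤ W.M t * normGT t (y - x)
  /-- the Slater point: feasible and at positive distance from the boundary of `ℋ` -/
  z_mem : W.zdag ∈ P.dom
  z_feas : P.opA W.zdag = P.d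
  z_dist : 0 < Metric.infDist W.zdag (frontier P.dom)

/-- `(z,q)` is a `(ρ,η)`-stationary pair:
`z ∈ ℋ`, `dist(0, ∇f(z) + A^*q + ∂h(z)) ≤ ρ` and `‖Az - d‖ ≤ η`
(the distance to the empty set being `∞`). -/
def IsStationaryPair (P : Problem E Y) (ρ η : ℝ) (z : PiLp 2 E) (q : Y) : Prop :=
  z ∈ P.dom ∧
  Metric.infEDist 0
    ((fun s => P.grad z + ContinuousLinearMap.adjoint P.opA q + s) '' subdiff P.hSum z)
      ≤ ENNReal.ofReal ρ ∧
  ‖P.feas z‖ ≤ η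

/-! ### The static method -/

/-- `x`, `p` are the iterates of the static method (Steps 1 and 3) from `x⁰`, `p⁰`. The stopping
tests do not influence the updates, so the sequences are continued for all `k`. -/
structure IsRun (P : Problem E Y) (S : Params) (c : ℝ) (x₀ : PiLp 2 E) (p₀ : Y)
    (x : ℕ → PiLp 2 E) (p : ℕ → Y) : Prop where
  x_zero : x 0 = x₀
  p_zero : p 0 = p₀
  x_step : ∀ k t, IsMinOn
    (fun u : E t => (S.lam : EReal) * P.lagr S.θ c (glue t (x (k + 1)) u (x k)) (p k)
      + ((1 / 2 * ‖u - x k t‖ ^ 2 : ℝ) : EReal)) Set.univ (x (k + 1) t)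
  p_step : ∀ k, p (k + 1) = (1 - S.θ) • p k + (S.χ * c) • P.feas (x (k + 1))

/-- `q^k`, for `k ≥ 1`. -/
def qIter (P : Problem E Y) (S : Params) (c : ℝ) (x : ℕ → PiLp 2 E) (p : ℕ → Y) (k : ℕ) : Y :=
  (1 - S.θ) • p (k - 1) + c • P.feas (x k)

/-- `v^k`, for `k ≥ 1`. -/
def vIter (P : Problem E Y) (S : Params) (c : ℝ) (x : ℕ → PiLp 2 E) (k : ℕ) : PiLp 2 E :=
  WithLp.toLp 2 fun t =>
    (P.grad (x k) t - P.grad (glue t (x k) (x k t) (x (k - 1))) t)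
    + c • ContinuousLinearMap.adjoint (P.A t)
        (∑ s ∈ Finset.Ioi t, P.A s (x k s - x (k - 1) s))
    - (1 / S.lam) • (x k t - x (k - 1) t)

/-- The test of Step 2a at iteration `k`. -/
def SuccessTest (P : Problem E Y) (S : Params) (ρ η c : ℝ) (x : ℕ → PiLp 2 E) (k : ℕ) : Prop :=
  ‖P.vIter S c x k‖ ≤ ρ ∧ ‖P.feas (x k)‖ ≤ η

/-- The test of Step 2b at iteration `k`. -/
def FailTest (P : Problem E Y) (S : Params) (ρ η c : ℝ) (x : ℕ → PiLp 2 E) (k : ℕ) : Prop :=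
  Even k ∧ 3 ≤ k ∧
  1 / ρ * (2 / ((k : ℝ) + 2) * ∑ i ∈ Finset.Icc (k / 2) k, ‖P.vIter S c x i‖)
    + 1 / η * Real.sqrt (c ^ 3 / (k : ℝ))
      * (2 / ((k : ℝ) + 2) * ∑ i ∈ Finset.Icc (k / 2) k, ‖P.feas (x i)‖) ≤ 1

/-- Neither test has stopped the method before iteration `k`. -/
def Reaches (P : Problem E Y) (S : Params) (ρ η c : ℝ) (x : ℕ → PiLp 2 E) (k : ℕ) : Prop :=
  1 ≤ k ∧ ∀ i, 1 ≤ i → i < k → ¬ P.SuccessTest S ρ η c x i ∧ ¬ P.FailTest S ρ η c x i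

/-- The method stops at iteration `k` in Step 2a. -/
def StopsSuccess (P : Problem E Y) (S : Params) (ρ η c : ℝ) (x : ℕ → PiLp 2 E) (k : ℕ) : Prop :=
  P.Reaches S ρ η c x k ∧ P.SuccessTest S ρ η c x k

/-- The method stops at iteration `k` in Step 2b. -/
def StopsFail (P : Problem E Y) (S : Params) (ρ η c : ℝ) (x : ℕ → PiLp 2 E) (k : ℕ) : Prop :=
  P.Reaches S ρ η c x k ∧ ¬ P.SuccessTest S ρ η c x k ∧ P.FailTest S ρ η c x k

/-! ### The constants -/

/-- `d_† = dist(z_†, ∂ℋ)`. -/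
def dDag (P : Problem E Y) (W : Moduli E) : ℝ := Metric.infDist W.zdag (frontier P.dom)

/-- `D_† = sup_{z ∈ ℋ} ‖z - z_†‖`. -/
def DDag (P : Problem E Y) (W : Moduli E) : ℝ := sSup ((fun z => ‖z - W.zdag‖) '' P.dom)

/-- `G_f = sup_{x ∈ ℋ} ‖∇f(x)‖`. -/
def Gf (P : Problem E Y) : ℝ := sSup ((fun x => ‖P.grad x‖) '' P.dom)

/-- `Δ_φ = sup_ℋ φ - inf_ℋ φ`. -/
def deltaPhi (P : Problem E Y) : ℝ :=
  sSup ((fun x => (P.phi x).toReal) '' P.dom) - sInf ((fun x => (P.phi x).toReal) '' P.dom)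

/-- `σ_A^+`, the smallest positive singular value of `A`. -/
def sigmaPlus (P : Problem E Y) : ℝ :=
  sInf {s : ℝ | 0 < s ∧ ∃ i, P.opA.toLinearMap.singularValues i = s}

/-- `‖A‖_† = ∑ ‖A_t‖`. -/
def normADag (P : Problem E Y) : ℝ := ∑ t, ‖P.A t‖

/-- `κ_0`. -/
def κ0 (_P : Problem E Y) (W : Moduli E) (S : Params) : ℝ :=
  2 * (B : ℝ) ^ 2 * (S.lam * W.MMax + 1) / Real.sqrt S.lam

/-- `κ_1`. -/
def κ1 (P : Problem E Y) (W : Moduli E) (S : Params) : ℝ := S.χ * ‖P.opA‖ * P.DDag W / S.θ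

/-- `κ_2`. -/
def κ2 (P : Problem E Y) (W : Moduli E) (S : Params) : ℝ :=
  1 / S.θ * (1 + 2 * S.χ * P.DDag W * (W.Kh + P.Gf) / (S.θ * P.dDag W * P.sigmaPlus)) + 1

/-- `κ_3`. -/
def κ3 (P : Problem E Y) (W : Moduli E) (S : Params) : ℝ := 108 * P.κ2 W S ^ 2 / S.χ ^ 2

/-- `κ_4`. -/
def κ4 (P : Problem E Y) (W : Moduli E) (S : Params) : ℝ :=
  S.θ * P.dDag W * P.sigmaPlus / (S.χ * P.DDag W)

/-- `κ_5`. -/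
def κ5 (P : Problem E Y) : ℝ := 8 * ((B : ℝ) - 1) * P.normADag ^ 2

/-- `κ_6`. -/
def κ6 (P : Problem E Y) (W : Moduli E) (S : Params) : ℝ :=
  3 + 8 * P.κ0 W S ^ 2 * P.deltaPhi / P.κ4 W S ^ 2

/-- `κ̃^{(0)}` for the lower bound `cl` on the penalty parameter. -/
def κt0 (P : Problem E Y) (W : Moduli E) (S : Params) (cl : ℝ) : ℝ :=
  2 * (Real.sqrt P.deltaPhi + 5 * P.κ2 W S / (S.χ * Real.sqrt cl))

/-- `κ̃^{(1)}`, the constant term of the `ρ⁻²` part of the iteration bound. -/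
def κt1 (P : Problem E Y) (W : Moduli E) (S : Params) (cl : ℝ) : ℝ :=
  3 * P.κ0 W S ^ 2 * P.κt0 W S cl ^ 2

/-- `κ̃^{(2)}`, the coefficient of `c` in the `ρ⁻²` part of the iteration bound. -/
def κt2 (P : Problem E Y) (W : Moduli E) (S : Params) (cl : ℝ) : ℝ :=
  3 * P.κ5 * P.κt0 W S cl ^ 2

/-- `ξ^{(0)}`. -/
def ξ0 (P : Problem E Y) (W : Moduli E) (S : Params) (R : ℝ) : ℝ :=
  8 / P.κ4 W S ^ 2 * (9 * P.κ0 W S ^ 2 * (R + P.κ1 W S) ^ 2 / S.χ ^ 2 + P.κ5 * P.deltaPhi)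
    + (1 - S.θ) * (R + P.κ1 W S)

/-- `ξ^{(1)}`. -/
def ξ1 (P : Problem E Y) (W : Moduli E) (S : Params) (R : ℝ) : ℝ :=
  72 * P.κ5 * (R + P.κ1 W S) ^ 2 / (S.χ ^ 2 * P.κ4 W S ^ 2)

/-- The iteration bound `𝒯_c(ρ, η | cl, R)`. -/
def iterBound (P : Problem E Y) (W : Moduli E) (S : Params) (c ρ η cl R : ℝ) : ℝ :=
  48 * ((P.κ6 W S + P.κt1 W S cl / ρ ^ 2)
    + (P.ξ0 W S R + P.κ3 W S / η ^ 2 + P.κt2 W S cl / ρ ^ 2) * c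
    + P.ξ1 W S R * c ^ 2)

/-- The penalty threshold `ĉ(ρ, η | cl, R)`. -/
def cHat (P : Problem E Y) (W : Moduli E) (S : Params) (ρ η cl R : ℝ) : ℝ :=
  1 / cl ^ 2 * (P.iterBound W S cl 1 1 cl R
    + Real.sqrt (cl ^ 3 * P.iterBound W S cl 1 1 cl R) / min ρ η)

end Problem

end DPADMM

end

noncomputable section

set_option linter.unusedSectionVars false

namespace DPADMM

/-! ### Sums of extended reals -/

/-! The proof bounds the multipliers on average, independently of `c`, although the only a priori
bound on them grows linearly in `c`.

Single sweep. Since `2mλ ≤ 1`, the prox term dominates the weak convexity of `f`, so every block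
subproblem is strongly convex. This gives existence and uniqueness of the iterates, and summing the
quadratic growth over the blocks gives a decrease of the Lagrangian (`lagrR_sweep_le`). The block
optimality conditions, all transported to the final point, say that `v - ∇f(x) - A^*q` is a
subgradient of `h` (`sweep_mem_subdiff`), which is (b). The same decrease controls `‖v‖²` up to the
factor `κ = κ0² + κ5 c`.

Potential. The multiplier step disturbs the decrease. The condition on `(χ,θ)` lets half of the
penalty part of the decrease pay for it, after two correction terms in `p` are added to the
Lagrangian (`potential_step`). Hence the sum of `‖v‖²` over a stretch is at most `κ` times the drop
of a nonincreasing potential, and that drop is at most `Δ_φ + O(s²/c)` when the multipliers at its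
two ends are of size `s`.

Multipliers. Testing the subgradient inequality at a perturbation of the Slater point yields `‖p⁺‖ ≤
(1-θ)‖p‖ + (2θ/κ4)(K_h + G_f + ‖v‖)` (`norm_multiplier_le`). On a window long enough that the crude
bound `s = c(R + κ1)` makes the mean of `‖v‖` at most `κ4/2`, averaging this recursion bounds the
mean multiplier by `κ2`. So there are indices near both ends of a long run with small multipliers.
Using these as end points bounds the drop of the potential independently of the crude bound
(`late_sum_sq_le`). Since the multiplier update bounds `‖Ax - d‖` by `1/(χc)` times two consecutive
multipliers, both averages in the test of Step 2b become small, and the method stops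
(`failTest_of_large`).

Success. If `k ≤ c³`, the weight `√(c³/k)` is at least `1`, so passing test 2b at `k` makes the
average of `‖v‖/ρ + ‖Ax - d‖/η` over the window at most `1`; some iterate of that window then passes
test 2a. The threshold `ĉ` is the value above which the iteration bound is at most `c³`
(`iterBound_le_cube`). -/

lemma ereal_sum_coe {ι : Type*} (s : Finset ι) (g : ι → ℝ) :
    ∑ i ∈ s, ((g i : ℝ) : EReal) = ((∑ i ∈ s, g i : ℝ) : EReal) := by
  classical
  induction s using Finset.induction_on with
  | empty => simp
  | insert a s ha ih => rw [Finset.sum_insert ha, Finset.sum_insert ha, ih, EReal.coe_add]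

lemma ereal_sum_ne_bot {ι : Type*} (s : Finset ι) (g : ι → EReal) (hg : ∀ i, g i ≠ ⊥) :
    ∑ i ∈ s, g i ≠ ⊥ := by
  classical
  induction s using Finset.induction_on with
  | empty => simp
  | insert a s ha ih =>
    rw [Finset.sum_insert ha]
    exact EReal.add_ne_bot_iff.2 ⟨hg a, ih⟩

lemma ereal_sum_eq_top {ι : Type*} (s : Finset ι) (g : ι → EReal) (hg : ∀ i, g i ≠ ⊥)
    {j : ι} (hj : j ∈ s) (hjt : g j = ⊤) : ∑ i ∈ s, g i = ⊤ := by
  classical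
  rw [← Finset.add_sum_erase s g hj, hjt]
  exact EReal.top_add_of_ne_bot (ereal_sum_ne_bot _ _ hg)

/-! ### Gluing blocks -/

section Glue

variable {B : ℕ} {E : Fin B → Type*}

@[simp] lemma glue_same (t : Fin B) (x : PiLp 2 E) (u : E t) (y : PiLp 2 E) :
    glue t x u y t = u := by
  simp [glue]

lemma glue_lt {t s : Fin B} (x : PiLp 2 E) (u : E t) (y : PiLp 2 E) (h : s < t) :
    glue t x u y s = x s := by
  simp [glue, Function.update_of_ne h.ne, h]

lemma glue_gt {t s : Fin B} (x : PiLp 2 E) (u : E t) (y : PiLp 2 E) (h : t < s) :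
    glue t x u y s = y s := by
  simp [glue, Function.update_of_ne h.ne', h.not_gt]

/-- Block `t` sees the new point only through its earlier blocks; this lets sweeps be built and
compared block by block. -/
lemma glue_congr {t : Fin B} {x x' : PiLp 2 E} (u : E t) (y : PiLp 2 E)
    (h : ∀ s < t, x s = x' s) : glue t x u y = glue t x' u y := by
  ext s
  rcases lt_trichotomy s t with hs | rfl | hs
  · rw [glue_lt _ _ _ hs, glue_lt _ _ _ hs, h s hs]
  · simp
  · rw [glue_gt _ _ _ hs, glue_gt _ _ _ hs]

/-- Weak convexity is assumed at points `(x_{<t}, u, x_{>t})` with a single base point; this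
transfers it to the mixed points of a sweep. -/
lemma glue_glue (t : Fin B) (x : PiLp 2 E) (u w : E t) (y : PiLp 2 E) :
    glue t (glue t x u y) w (glue t x u y) = glue t x w y := by
  ext s
  rcases lt_trichotomy s t with hs | rfl | hs
  · rw [glue_lt _ _ _ hs, glue_lt _ _ _ hs, glue_lt _ _ _ hs]
  · simp
  · rw [glue_gt _ _ _ hs, glue_gt _ _ _ hs, glue_gt _ _ _ hs]

variable [∀ t, NormedAddCommGroup (E t)] [∀ t, InnerProductSpace ℝ (E t)]

lemma glue_eq_add_single (t : Fin B) (x : PiLp 2 E) (u w : E t) (y : PiLp 2 E) :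
    glue t x w y = glue t x u y + PiLp.single 2 t (w - u) := by
  ext s
  rcases lt_trichotomy s t with hs | rfl | hs
  · simp [glue_lt _ _ _ hs, hs.ne]
  · simp
  · simp [glue_gt _ _ _ hs, hs.ne']

lemma norm_single (t : Fin B) (w : E t) : ‖(PiLp.single 2 t w : PiLp 2 E)‖ = ‖w‖ := by
  have h := PiLp.norm_sq_eq_of_L2 E (PiLp.single 2 t w)
  rw [Finset.sum_eq_single t] at h
  · rw [PiLp.single_eq_same] at h
    exact (sq_eq_sq₀ (norm_nonneg _) (norm_nonneg _)).1 h
  · intro s _ hs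
    simp [hs]
  · simp

lemma inner_single_right (t : Fin B) (g : PiLp 2 E) (w : E t) :
    inner ℝ g (PiLp.single 2 t w : PiLp 2 E) = inner ℝ (g t) w := by
  rw [PiLp.inner_apply, Finset.sum_eq_single t]
  · rw [PiLp.single_eq_same]
  · intro s _ hs
    simp [hs]
  · simp

/-- The exact convexity defect of the squared norm. It is the source of every strong convexity
modulus below and of the contraction of the multiplier increments. -/
lemma convex_comb_norm_sq {V : Type*} [NormedAddCommGroup V] [InnerProductSpace ℝ V]
    (a b : V) (s : ℝ) :
    ‖(1 - s) • a + s • b‖ ^ 2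
      = (1 - s) * ‖a‖ ^ 2 + s * ‖b‖ ^ 2 - s * (1 - s) * ‖a - b‖ ^ 2 := by
  rw [norm_add_sq_real, norm_sub_sq_real, norm_smul, norm_smul, inner_smul_left, inner_smul_right]
  simp only [mul_pow, Real.norm_eq_abs, sq_abs, conj_trivial]
  ring

end Glue

/-! ### Reduction of the extended-valued subproblems to finite functions; geometry of the domain. -/

namespace Problem

variable {B : ℕ} {E : Fin B → Type*} {Y : Type*}
  [∀ t, NormedAddCommGroup (E t)] [∀ t, InnerProductSpace ℝ (E t)]
  [NormedAddCommGroup Y] [InnerProductSpace ℝ Y]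

lemma opA_apply (P : Problem E Y) (x : PiLp 2 E) : P.opA x = ∑ t, P.A t (x t) := by
  simp [opA]

lemma opA_single (P : Problem E Y) (t : Fin B) (w : E t) :
    P.opA (PiLp.single 2 t w) = P.A t w := by
  rw [opA_apply, Finset.sum_eq_single t]
  · rw [PiLp.single_eq_same]
  · intro s _ hs
    simp [hs]
  · simp

/-- The finite part of `φ`. -/
def phiR (P : Problem E Y) (x : PiLp 2 E) : ℝ := P.f x + ∑ t, (P.h t (x t)).toReal

/-- The finite part of the dampened augmented Lagrangian. -/
def lagrR (P : Problem E Y) (θ c : ℝ) (x : PiLp 2 E) (p : Y) : ℝ :=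
  P.phiR x + ((1 - θ) * inner ℝ p (P.feas x) + c / 2 * ‖P.feas x‖ ^ 2)

/-- The finite part of the objective of the subproblem of block `t`. -/
def blockObj (P : Problem E Y) (S : Params) (c : ℝ) (p : Y) (t : Fin B) (x y : PiLp 2 E)
    (u : E t) : ℝ :=
  S.lam * P.lagrR S.θ c (glue t x u y) p + 1 / 2 * ‖u - y t‖ ^ 2

lemma glue_mem_dom {P : Problem E Y} {t : Fin B} {x y : PiLp 2 E} {u : E t}
    (hx : ∀ s < t, x s ∈ P.domBlock s) (hu : u ∈ P.domBlock t)
    (hy : y ∈ P.dom) : glue t x u y ∈ P.dom := by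
  intro s
  rcases lt_trichotomy s t with hs | rfl | hs
  · rw [glue_lt _ _ _ hs]; exact hx s hs
  · simpa using hu
  · rw [glue_gt _ _ _ hs]; exact hy s

variable [∀ t, FiniteDimensional ℝ (E t)] [FiniteDimensional ℝ Y]
variable {P : Problem E Y} {W : Moduli E}

namespace Assumptions

lemma h_coe (hP : P.Assumptions W) {t : Fin B} {u : E t} (hu : u ∈ P.domBlock t) :
    P.h t u = ((P.h t u).toReal : EReal) :=
  (EReal.coe_toReal (ne_of_lt hu) (hP.h_ne_bot t u)).symm

lemma h_top (_hP : P.Assumptions W) {t : Fin B} {u : E t} (hu : u ∉ P.domBlock t) : P.h t u = ⊤ :=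
  not_lt_top_iff.1 hu

lemma hSum_coe (hP : P.Assumptions W) {x : PiLp 2 E} (hx : x ∈ P.dom) :
    P.hSum x = ((∑ t, (P.h t (x t)).toReal : ℝ) : EReal) := by
  rw [hSum, ← ereal_sum_coe]
  exact Finset.sum_congr rfl fun t _ => hP.h_coe (hx t)

lemma hSum_top (hP : P.Assumptions W) {x : PiLp 2 E} (hx : x ∉ P.dom) : P.hSum x = ⊤ := by
  obtain ⟨t, ht⟩ := not_forall.1 hx
  exact ereal_sum_eq_top _ _ (fun t => hP.h_ne_bot t _) (Finset.mem_univ t) (hP.h_top ht)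

lemma phi_coe (hP : P.Assumptions W) {x : PiLp 2 E} (hx : x ∈ P.dom) :
    P.phi x = (P.phiR x : EReal) := by
  rw [phi, hP.hSum_coe hx, phiR, EReal.coe_add]

lemma lagr_coe (hP : P.Assumptions W) {x : PiLp 2 E} (hx : x ∈ P.dom) (θ c : ℝ) (p : Y) :
    P.lagr θ c x p = (P.lagrR θ c x p : EReal) := by
  rw [lagr, hP.phi_coe hx, lagrR, ← EReal.coe_add]

lemma lagr_top (hP : P.Assumptions W) {x : PiLp 2 E} (hx : x ∉ P.dom) (θ c : ℝ) (p : Y) :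
    P.lagr θ c x p = ⊤ := by
  rw [lagr, phi, hP.hSum_top hx, EReal.coe_add_top, EReal.top_add_coe]

/-- The subproblem of block `t` is the minimization of a finite function over `ℋ_t`. -/
lemma isMinOn_block_iff (hP : P.Assumptions W) {S : Params} (hlam : 0 < S.lam) (c : ℝ)
    (p : Y) {t : Fin B} {x y : PiLp 2 E} (hx : ∀ s < t, x s ∈ P.domBlock s) (hy : y ∈ P.dom) (w : E t) :
    IsMinOn (fun u : E t => (S.lam : EReal) * P.lagr S.θ c (glue t x u y) p
      + ((1 / 2 * ‖u - y t‖ ^ 2 : ℝ) : EReal)) Set.univ w ↔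
    w ∈ P.domBlock t ∧ ∀ u ∈ P.domBlock t,
      P.blockObj S c p t x y w ≤ P.blockObj S c p t x y u := by
  have hin : ∀ u ∈ P.domBlock t, (S.lam : EReal) * P.lagr S.θ c (glue t x u y) p
      + ((1 / 2 * ‖u - y t‖ ^ 2 : ℝ) : EReal) = (P.blockObj S c p t x y u : EReal) := by
    intro u hu
    rw [hP.lagr_coe (glue_mem_dom hx hu hy), blockObj, ← EReal.coe_mul, ← EReal.coe_add]
  have hout : ∀ u ∉ P.domBlock t, (S.lam : EReal) * P.lagr S.θ c (glue t x u y) p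
      + ((1 / 2 * ‖u - y t‖ ^ 2 : ℝ) : EReal) = ⊤ := by
    intro u hu
    rw [hP.lagr_top (fun h => hu (by simpa using h t)),
      EReal.coe_mul_top_of_pos hlam, EReal.top_add_coe]
  simp only [isMinOn_iff, Set.mem_univ, forall_const]
  constructor
  · intro h
    have hw : w ∈ P.domBlock t := by
      by_contra hw
      -- The previous block is a competitor with finite value, so a minimizer cannot lie outside the
      -- domain.
      have := h (y t)
      rw [hout w hw, hin _ (hy t)] at this
      exact absurd this (not_le.2 (EReal.coe_lt_top _))
    refine ⟨hw, fun u hu => ?_⟩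
    have := h u
    rw [hin w hw, hin u hu] at this
    exact EReal.coe_le_coe_iff.1 this
  · rintro ⟨hw, h⟩ u
    by_cases hu : u ∈ P.domBlock t
    · rw [hin w hw, hin u hu]
      exact EReal.coe_le_coe_iff.2 (h u hu)
    · rw [hout u hu]
      exact le_top

/-! ### Geometry of the domain -/

lemma h_convexOn (hP : P.Assumptions W) (t : Fin B) :
    ConvexOn ℝ (P.domBlock t) fun u => (P.h t u).toReal := by
  have key : ∀ u ∈ P.domBlock t, ∀ v ∈ P.domBlock t, ∀ a b : ℝ, 0 ≤ a → 0 ≤ b → a + b = 1 →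
      P.h t (a • u + b • v) ≤
        ((a * (P.h t u).toReal + b * (P.h t v).toReal : ℝ) : EReal) := by
    intro u hu v hv a b ha hb hab
    have := hP.h_convex t (x := (u, (P.h t u).toReal)) (hP.h_coe hu).le
      (y := (v, (P.h t v).toReal)) (hP.h_coe hv).le ha hb hab
    simpa using this
  have hconv : Convex ℝ (P.domBlock t) := by
    intro u hu v hv a b ha hb hab
    exact (key u hu v hv a b ha hb hab).trans_lt (EReal.coe_lt_top _)
  refine ⟨hconv, ?_⟩
  intro u hu v hv a b ha hb hab
  have h1 := key u hu v hv a b ha hb hab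
  rw [hP.h_coe (hconv hu hv ha hb hab)] at h1
  exact EReal.coe_le_coe_iff.1 h1

lemma convex_domBlock (hP : P.Assumptions W) (t : Fin B) : Convex ℝ (P.domBlock t) :=
  (hP.h_convexOn t).1

lemma convex_dom (hP : P.Assumptions W) : Convex ℝ P.dom := by
  intro x hx y hy a b ha hb hab t
  exact hP.convex_domBlock t (hx t) (hy t) ha hb hab

lemma isCompact_dom (hP : P.Assumptions W) : IsCompact P.dom := by
  have h1 : IsCompact (Set.univ.pi P.domBlock) := isCompact_univ_pi hP.h_compact
  have h2 : P.dom = PiLp.homeomorph 2 E ⁻¹' (Set.univ.pi P.domBlock) := by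
    ext x
    simp [dom, PiLp.homeomorph]
  rw [h2]
  exact (PiLp.homeomorph 2 E).isCompact_preimage.2 h1

/-- By connectedness: a ball that avoids the frontier lies either in the interior or in the exterior
of the domain, and its centre belongs to the domain. Convexity of the domain plays no role. -/
lemma ball_subset_dom (hP : P.Assumptions W) : Metric.ball W.zdag (P.dDag W) ⊆ P.dom := by
  intro z hz
  by_contra hzn
  have hne : (Metric.ball W.zdag (P.dDag W) ∩ frontier P.dom).Nonempty := by
    by_contra hne
    have hsub : Metric.ball W.zdag (P.dDag W) ⊆ interior P.dom ∪ (closure P.dom)ᶜ := by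
      intro w hw
      by_contra hwn
      rw [Set.mem_union, Set.mem_compl_iff] at hwn
      push Not at hwn
      exact hne ⟨w, hw, hwn.2, hwn.1⟩
    have hz' := (convex_ball W.zdag (P.dDag W)).isPreconnected.subset_left_of_subset_union
      isOpen_interior isClosed_closure.isOpen_compl
      (disjoint_compl_right.mono_left (interior_subset.trans subset_closure)) hsub
      ⟨W.zdag, Metric.mem_ball_self hP.z_dist, (hsub (Metric.mem_ball_self hP.z_dist)).resolve_right
        fun h => h (subset_closure hP.z_mem)⟩ hz
    exact hzn (interior_subset hz')
  obtain ⟨w, hw, hwf⟩ := hne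
  have := Metric.infDist_le_dist_of_mem (x := W.zdag) hwf
  rw [Metric.mem_ball, dist_comm] at hw
  exact absurd this (not_le.2 hw)

lemma hasGradientWithinAt (hP : P.Assumptions W) {x : PiLp 2 E} (hx : x ∈ P.dom) :
    HasGradientWithinAt P.f (P.grad x) P.dom x :=
  (hP.f_diff x hx).hasGradientWithinAt

lemma blocks_pos (hP : P.Assumptions W) : 0 < B := by
  rcases Nat.eq_zero_or_pos B with rfl | h
  · exact absurd (by simp [opA]) hP.A_ne
  · exact h

end Assumptions

end Problem

/-! ### Strong convexity of the subproblems, sweeps, and existence and uniqueness of the run. -/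

namespace Problem

variable {B : ℕ} {E : Fin B → Type*} {Y : Type*}
  [∀ t, NormedAddCommGroup (E t)] [∀ t, InnerProductSpace ℝ (E t)]
  [NormedAddCommGroup Y] [InnerProductSpace ℝ Y]

lemma feas_glue_sub (P : Problem E Y) (t : Fin B) (x y : PiLp 2 E) (u w : E t) :
    P.feas (glue t x u y) - P.feas (glue t x w y) = P.A t (u - w) := by
  rw [glue_eq_add_single t x w u y, feas, feas, map_add, opA_single]
  abel

lemma feas_glue_comb (P : Problem E Y) (t : Fin B) (x y : PiLp 2 E) (u w : E t) (s : ℝ) :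
    P.feas (glue t x ((1 - s) • u + s • w) y)
      = (1 - s) • P.feas (glue t x u y) + s • P.feas (glue t x w y) := by
  have h1 := P.feas_glue_sub t x y ((1 - s) • u + s • w) u
  have h2 := P.feas_glue_sub t x y w u
  have h3 : (1 - s) • u + s • w - u = s • (w - u) := by module
  rw [h3, map_smul, ← h2] at h1
  rw [sub_eq_iff_eq_add.1 h1]
  module

lemma continuous_glue (t : Fin B) (x y : PiLp 2 E) : Continuous fun u : E t => glue t x u y := by
  have h : (fun u : E t => glue t x u y)
      = fun u : E t => WithLp.toLp 2 (Function.update (fun s => if s < t then x s else y s) t u) :=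
    rfl
  rw [h]
  exact (PiLp.continuous_toLp 2 E).comp (continuous_const.update t continuous_id)

variable [∀ t, FiniteDimensional ℝ (E t)] [FiniteDimensional ℝ Y]
variable {P : Problem E Y} {W : Moduli E} {S : Params}

lemma le_mMax (W : Moduli E) (t : Fin B) : W.m t ≤ W.mMax :=
  le_ciSup (Set.finite_range _).bddAbove t

lemma le_MMax (W : Moduli E) (t : Fin B) : W.M t ≤ W.MMax :=
  le_ciSup (Set.finite_range _).bddAbove t

namespace Assumptions

lemma continuousOn_phiR (hP : P.Assumptions W) : ContinuousOn P.phiR P.dom := by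
  have hh : ContinuousOn (fun x : PiLp 2 E => ∑ t, (P.h t (x t)).toReal) P.dom := by
    have : LipschitzOnWith (Real.toNNReal W.Kh)
        (fun x : PiLp 2 E => ∑ t, (P.h t (x t)).toReal) P.dom := by
      apply LipschitzOnWith.of_dist_le_mul
      intro x hx y hy
      have := hP.h_lip x hx y hy
      rw [hP.hSum_coe hx, hP.hSum_coe hy, EReal.toReal_coe, EReal.toReal_coe] at this
      rwa [Real.dist_eq, dist_eq_norm, Real.coe_toNNReal _ hP.Kh_nonneg]
    exact this.continuousOn
  exact hP.f_diff.continuousOn.add hh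

lemma continuousOn_lagrR (hP : P.Assumptions W) (θ c : ℝ) (p : Y) :
    ContinuousOn (fun x => P.lagrR θ c x p) P.dom := by
  have hf : Continuous P.feas := P.opA.continuous.sub continuous_const
  apply hP.continuousOn_phiR.add
  apply Continuous.continuousOn
  fun_prop

lemma continuousOn_blockObj (hP : P.Assumptions W) (c : ℝ) (p : Y) {t : Fin B} {x y : PiLp 2 E}
    (hx : ∀ s < t, x s ∈ P.domBlock s) (hy : y ∈ P.dom) :
    ContinuousOn (P.blockObj S c p t x y) (P.domBlock t) := by
  have h1 : ContinuousOn (fun u : E t => P.lagrR S.θ c (glue t x u y) p) (P.domBlock t) :=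
    (hP.continuousOn_lagrR S.θ c p).comp (continuous_glue t x y).continuousOn
      fun u hu => glue_mem_dom hx hu hy
  exact (continuousOn_const.mul h1).add (by fun_prop)

/-- Each subproblem objective is strongly convex on its domain. -/
lemma blockObj_comb_le (hP : P.Assumptions W) (hS : S.Admissible B W.mMax) (c : ℝ) (p : Y)
    {t : Fin B} {x y : PiLp 2 E} (hx : ∀ s < t, x s ∈ P.domBlock s) (hy : y ∈ P.dom)
    {u w : E t} (hu : u ∈ P.domBlock t) (hw : w ∈ P.domBlock t) {s : ℝ} (hs0 : 0 ≤ s)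
    (hs1 : s ≤ 1) :
    P.blockObj S c p t x y ((1 - s) • u + s • w) ≤
      (1 - s) * P.blockObj S c p t x y u + s * P.blockObj S c p t x y w
        - s * (1 - s) * (1 / 4 * ‖u - w‖ ^ 2 + S.lam * c / 2 * ‖P.A t (u - w)‖ ^ 2) := by
  have hs1' : 0 ≤ 1 - s := by linarith
  have hf := (hP.f_weak t _ (glue_mem_dom hx hu hy)).2 hu hw hs1' hs0 (by ring)
  simp only [glue_glue, smul_eq_mul] at hf
  rw [convex_comb_norm_sq] at hf
  have hh : ∑ r, (P.h r (glue t x ((1 - s) • u + s • w) y r)).toReal ≤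
      (1 - s) * ∑ r, (P.h r (glue t x u y r)).toReal + s * ∑ r, (P.h r (glue t x w y r)).toReal := by
    rw [Finset.mul_sum, Finset.mul_sum, ← Finset.sum_add_distrib]
    apply Finset.sum_le_sum
    intro r _
    rcases lt_trichotomy r t with hr | rfl | hr
    · simp only [glue_lt _ _ _ hr]; apply le_of_eq; ring
    · simp only [glue_same]
      exact (hP.h_convexOn r).2 hu hw hs1' hs0 (by ring)
    · simp only [glue_gt _ _ _ hr]; apply le_of_eq; ring
  have hq : ‖P.feas (glue t x ((1 - s) • u + s • w) y)‖ ^ 2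
      = (1 - s) * ‖P.feas (glue t x u y)‖ ^ 2 + s * ‖P.feas (glue t x w y)‖ ^ 2
        - s * (1 - s) * ‖P.A t (u - w)‖ ^ 2 := by
    rw [feas_glue_comb, convex_comb_norm_sq, feas_glue_sub]
  have hi : inner ℝ p (P.feas (glue t x ((1 - s) • u + s • w) y))
      = (1 - s) * inner ℝ p (P.feas (glue t x u y)) + s * inner ℝ p (P.feas (glue t x w y)) := by
    rw [feas_glue_comb, inner_add_right, inner_smul_right, inner_smul_right]
  have hn : ‖(1 - s) • u + s • w - y t‖ ^ 2
      = (1 - s) * ‖u - y t‖ ^ 2 + s * ‖w - y t‖ ^ 2 - s * (1 - s) * ‖u - w‖ ^ 2 := by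
    have h1 : (1 - s) • u + s • w - y t = (1 - s) • (u - y t) + s • (w - y t) := by module
    have h2 : (u - y t) - (w - y t) = u - w := by abel
    rw [h1, convex_comb_norm_sq, h2]
  -- The defect of `λf` costs at most `λm_t/2 ≤ 1/4` of the modulus `1/2` supplied by the prox term;
  -- the remaining `1/4` is the one in the statement.
  have hm : 2 * W.m t * S.lam ≤ 1 :=
    le_trans (by nlinarith [le_mMax W t, hS.lam_pos]) hS.lam_le
  have hz : 0 ≤ s * (1 - s) * ‖u - w‖ ^ 2 := by positivity
  have h1 := mul_le_mul_of_nonneg_left hf hS.lam_pos.le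
  have h2 := mul_le_mul_of_nonneg_left hh hS.lam_pos.le
  have h3 := mul_le_mul_of_nonneg_right hm hz
  unfold blockObj lagrR phiR
  rw [hq, hi, hn]
  linarith

/-- Quadratic growth of a subproblem objective around its minimizer. -/
lemma blockObj_growth (hP : P.Assumptions W) (hS : S.Admissible B W.mMax) (c : ℝ) (p : Y)
    {t : Fin B} {x y : PiLp 2 E} (hx : ∀ s < t, x s ∈ P.domBlock s) (hy : y ∈ P.dom)
    {u w : E t} (hu : u ∈ P.domBlock t) (hw : w ∈ P.domBlock t)
    (hmin : ∀ z ∈ P.domBlock t, P.blockObj S c p t x y u ≤ P.blockObj S c p t x y z) :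
    P.blockObj S c p t x y u + (1 / 4 * ‖u - w‖ ^ 2 + S.lam * c / 2 * ‖P.A t (u - w)‖ ^ 2)
      ≤ P.blockObj S c p t x y w := by
  set Q := 1 / 4 * ‖u - w‖ ^ 2 + S.lam * c / 2 * ‖P.A t (u - w)‖ ^ 2 with hQ
  -- Comparing the minimizer with a point of the segment and dividing by `s` leaves a factor `1 -
  -- s`, which disappears as `s → 0`.
  have key : ∀ s : ℝ, 0 < s → s < 1 →
      (1 - s) * Q ≤ P.blockObj S c p t x y w - P.blockObj S c p t x y u := by
    intro s hs0 hs1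
    have h1 := hP.blockObj_comb_le hS c p hx hy hu hw hs0.le hs1.le
    have h2 := hmin _ (hP.convex_domBlock t hu hw (by linarith : (0 : ℝ) ≤ 1 - s) hs0.le (by ring))
    rw [← hQ] at h1
    have h3 : s * ((1 - s) * Q) ≤
        s * (P.blockObj S c p t x y w - P.blockObj S c p t x y u) := by linarith
    exact le_of_mul_le_mul_left h3 hs0
  have hlim : Filter.Tendsto (fun s : ℝ => (1 - s) * Q) (nhdsWithin 0 (Set.Ioi 0)) (nhds Q) := by
    have : Continuous fun s : ℝ => (1 - s) * Q := by fun_prop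
    simpa using (this.tendsto 0).mono_left nhdsWithin_le_nhds
  have := le_of_tendsto hlim (b := P.blockObj S c p t x y w - P.blockObj S c p t x y u)
    (by filter_upwards [Ioo_mem_nhdsGT (zero_lt_one' ℝ)] with s hs using key s hs.1 hs.2)
  linarith

end Assumptions

/-- `x` results from `y` by one pass over the blocks with multiplier `p`. -/
def IsSweep (P : Problem E Y) (S : Params) (c : ℝ) (p : Y) (y x : PiLp 2 E) : Prop :=
  ∀ t, x t ∈ P.domBlock t ∧ ∀ u ∈ P.domBlock t,
    P.blockObj S c p t x y (x t) ≤ P.blockObj S c p t x y u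

lemma IsSweep.mem_dom {c : ℝ} {p : Y} {y x : PiLp 2 E} (h : P.IsSweep S c p y x) : x ∈ P.dom :=
  fun t => (h t).1

lemma blockObj_congr (c : ℝ) (p : Y) {t : Fin B} {x x' : PiLp 2 E} (y : PiLp 2 E)
    (h : ∀ s < t, x s = x' s) : P.blockObj S c p t x y = P.blockObj S c p t x' y := by
  funext u
  rw [blockObj, blockObj, glue_congr u y h]

namespace Assumptions

/-- The reduction to a finite function for block `t` requires the earlier new blocks to lie in their
domains, hence the strong induction over blocks. -/
lemma isSweep_iff (hP : P.Assumptions W) (hlam : 0 < S.lam) (c : ℝ) (p : Y) {y : PiLp 2 E}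
    (hy : y ∈ P.dom) (x : PiLp 2 E) :
    (∀ t, IsMinOn (fun u : E t => (S.lam : EReal) * P.lagr S.θ c (glue t x u y) p
      + ((1 / 2 * ‖u - y t‖ ^ 2 : ℝ) : EReal)) Set.univ (x t)) ↔ P.IsSweep S c p y x := by
  constructor
  · intro h
    have hmem : ∀ t, x t ∈ P.domBlock t := by
      intro t
      induction t using WellFoundedLT.induction with
      | ind t ih => exact ((hP.isMinOn_block_iff hlam c p ih hy (x t)).1 (h t)).1
    exact fun t => (hP.isMinOn_block_iff hlam c p (fun s _ => hmem s) hy (x t)).1 (h t)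
  · intro h t
    exact (hP.isMinOn_block_iff hlam c p (fun s _ => (h s).1) hy (x t)).2 (h t)

lemma isSweep_unique (hP : P.Assumptions W) (hS : S.Admissible B W.mMax) {c : ℝ} (hc : 0 ≤ c)
    {p : Y} {y x x' : PiLp 2 E} (hy : y ∈ P.dom) (h : P.IsSweep S c p y x)
    (h' : P.IsSweep S c p y x') : x = x' := by
  have key : ∀ t, x t = x' t := by
    intro t
    induction t using WellFoundedLT.induction with
    | ind t ih =>
      have hmin' := (h' t).2
      rw [← blockObj_congr c p y ih] at hmin'
      have h1 := hP.blockObj_growth hS c p (fun s _ => (h s).1) hy (h t).1 (h' t).1 (h t).2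
      have h2 := hmin' _ (h t).1
      have h3 : 0 ≤ S.lam * c / 2 * ‖P.A t (x t - x' t)‖ ^ 2 := by
        have := hS.lam_pos
        positivity
      have h4 : ‖x t - x' t‖ ^ 2 ≤ 0 := by linarith
      have h5 : ‖x t - x' t‖ = 0 := by
        have := sq_nonneg ‖x t - x' t‖
        exact pow_eq_zero_iff (two_ne_zero) |>.1 (le_antisymm h4 this)
      exact sub_eq_zero.1 (norm_eq_zero.1 h5)
  ext t
  exact key t

lemma exists_isSweep (hP : P.Assumptions W) (c : ℝ) (p : Y) {y : PiLp 2 E} (hy : y ∈ P.dom) :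
    ∃ x, P.IsSweep S c p y x := by
  -- Induction on the number of blocks already minimized. The blocks of the witness from `n` on are
  -- irrelevant, because a subproblem reads its later blocks from `y`.
  have key : ∀ n : ℕ, ∃ x : PiLp 2 E, ∀ t : Fin B, t.val < n → x t ∈ P.domBlock t ∧
      ∀ u ∈ P.domBlock t, P.blockObj S c p t x y (x t) ≤ P.blockObj S c p t x y u := by
    intro n
    induction n with
    | zero => exact ⟨y, fun t ht => absurd ht (by omega)⟩
    | succ n ih =>
      obtain ⟨x, hx⟩ := ih
      by_cases hn : n < B
      · let r : Fin B := ⟨n, hn⟩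
        have hxr : ∀ s < r, x s ∈ P.domBlock s := fun s hs => (hx s hs).1
        obtain ⟨w, hw, hmin⟩ := (hP.h_compact r).exists_isMinOn (hP.h_proper r)
          (hP.continuousOn_blockObj (S := S) c p hxr hy)
        refine ⟨glue r x w y, fun t ht => ?_⟩
        have hcongr : ∀ t ≤ r, ∀ s < t, glue r x w y s = x s := fun t ht s hs =>
          glue_lt _ _ _ (hs.trans_le ht)
        rcases (Nat.lt_succ_iff_lt_or_eq.1 ht) with ht' | ht'
        · have htr : t < r := ht'
          rw [glue_lt _ _ _ htr, blockObj_congr c p y (hcongr t htr.le)]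
          exact hx t ht'
        · obtain rfl : t = r := Fin.ext ht'
          rw [glue_same, blockObj_congr c p y (hcongr r le_rfl)]
          exact ⟨hw, fun u hu => isMinOn_iff.1 hmin u hu⟩
      · exact ⟨x, fun t _ => hx t (by omega)⟩
  obtain ⟨x, hx⟩ := key B
  exact ⟨x, fun t => hx t t.isLt⟩

/-- A run stays in the domain and consists of sweeps. -/
lemma run_isSweep (hP : P.Assumptions W) (hlam : 0 < S.lam) {c : ℝ}
    {x₀ : PiLp 2 E} {p₀ : Y} (hx₀ : x₀ ∈ P.dom) {x : ℕ → PiLp 2 E} {p : ℕ → Y}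
    (hrun : P.IsRun S c x₀ p₀ x p) (k : ℕ) :
    x k ∈ P.dom ∧ P.IsSweep S c (p k) (x k) (x (k + 1)) := by
  have hmem : x k ∈ P.dom := by
    induction k with
    | zero => rw [hrun.x_zero]; exact hx₀
    | succ k ih => exact ((hP.isSweep_iff hlam c (p k) ih _).1 (hrun.x_step k)).mem_dom
  exact ⟨hmem, (hP.isSweep_iff hlam c (p k) hmem _).1 (hrun.x_step k)⟩

theorem existsUnique_run (hP : P.Assumptions W) (hS : S.Admissible B W.mMax) {c : ℝ}
    (hc : 0 ≤ c) {x₀ : PiLp 2 E} (hx₀ : x₀ ∈ P.dom) (p₀ : Y) :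
    ∃! s : (ℕ → PiLp 2 E) × (ℕ → Y), P.IsRun S c x₀ p₀ s.1 s.2 := by
  have hex : ∀ (z : P.dom × Y), ∃ x : PiLp 2 E, P.IsSweep S c z.2 z.1 x :=
    fun z => hP.exists_isSweep c z.2 z.1.2
  choose g hg using hex
  -- The recursion runs on the subtype of the domain, since a next sweep is only guaranteed from
  -- points of the domain.
  let F : ℕ → P.dom × Y := fun k => Nat.rec (⟨x₀, hx₀⟩, p₀)
    (fun _ z => (⟨g z, (hg z).mem_dom⟩, (1 - S.θ) • z.2 + (S.χ * c) • P.feas (g z))) k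
  refine ⟨(fun k => (F k).1, fun k => (F k).2), ⟨rfl, rfl, fun k => ?_, fun k => rfl⟩, ?_⟩
  · exact (hP.isSweep_iff hS.lam_pos c _ (F k).1.2 _).2 (hg (F k))
  · rintro ⟨x, p⟩ hrun
    have key : ∀ k, x k = (F k).1 ∧ p k = (F k).2 := by
      intro k
      induction k with
      | zero => exact ⟨hrun.x_zero, hrun.p_zero⟩
      | succ k ih =>
        have h1 := (hP.run_isSweep hS.lam_pos hx₀ hrun k).2
        simp only [ih.1, ih.2] at h1
        have h2 : x (k + 1) = (F (k + 1)).1 :=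
          hP.isSweep_unique hS hc (F k).1.2 h1 (hg (F k))
        refine ⟨h2, ?_⟩
        have h3 := hrun.p_step k
        simp only [h2, ih.2] at h3
        exact h3
    exact Prod.ext (funext fun k => (key k).1) (funext fun k => (key k).2)

end Assumptions

end Problem

lemma pilp_norm_le_sum {B : ℕ} {E : Fin B → Type*} [∀ t, NormedAddCommGroup (E t)]
    [∀ t, InnerProductSpace ℝ (E t)] (x : PiLp 2 E) : ‖x‖ ≤ ∑ t, ‖x t‖ := by
  have h : x = ∑ t, (PiLp.single 2 t (x t) : PiLp 2 E) := by
    ext s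
    rw [WithLp.ofLp_sum, Finset.sum_apply, Finset.sum_eq_single s]
    · rw [PiLp.single_eq_same]
    · intro t _ ht
      simp [ht.symm]
    · simp
  calc ‖x‖ = ‖∑ t, (PiLp.single 2 t (x t) : PiLp 2 E)‖ := by rw [← h]
    _ ≤ ∑ t, ‖(PiLp.single 2 t (x t) : PiLp 2 E)‖ := norm_sum_le _ _
    _ = ∑ t, ‖x t‖ := Finset.sum_congr rfl fun t _ => norm_single t _

lemma normGT_le_norm {B : ℕ} {E : Fin B → Type*} [∀ t, NormedAddCommGroup (E t)]
    [∀ t, InnerProductSpace ℝ (E t)] (t : Fin B) (x : PiLp 2 E) : normGT t x ≤ ‖x‖ := by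
  rw [normGT]
  apply Real.sqrt_le_iff.2 ⟨norm_nonneg _, ?_⟩
  rw [PiLp.norm_sq_eq_of_L2]
  exact Finset.sum_le_sum_of_subset_of_nonneg (Finset.subset_univ _) fun _ _ _ => sq_nonneg _

lemma pilp_norm_apply_le {B : ℕ} {E : Fin B → Type*} [∀ t, NormedAddCommGroup (E t)]
    [∀ t, InnerProductSpace ℝ (E t)] (x : PiLp 2 E) (t : Fin B) : ‖x t‖ ≤ ‖x‖ :=
  PiLp.norm_apply_le x t

/-- A one-sided first-order necessary condition at the left end of an interval. -/
lemma hasDerivWithinAt_nonneg_of_min {r : ℝ → ℝ} {r' : ℝ}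
    (hr : HasDerivWithinAt r r' (Set.Icc 0 1) 0) (hmin : ∀ s ∈ Set.Icc (0 : ℝ) 1, r 0 ≤ r s) :
    0 ≤ r' := by
  have h1 : HasDerivWithinAt r r' (Set.Ioi 0) 0 :=
    (hr.mono_of_mem_nhdsWithin (Icc_mem_nhdsGE zero_lt_one)).mono Set.Ioi_subset_Ici_self
  rw [hasDerivWithinAt_iff_tendsto_slope' (by simp)] at h1
  refine ge_of_tendsto h1 ?_
  filter_upwards [Ioo_mem_nhdsGT (zero_lt_one' ℝ)] with s hs
  rw [slope_def_field, sub_zero]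
  exact div_nonneg (sub_nonneg.2 (hmin s ⟨hs.1.le, hs.2.le⟩)) hs.1.le

/-! ### Decrease along a sweep, size of the residual, and first-order optimality. -/

namespace Problem

variable {B : ℕ} {E : Fin B → Type*} {Y : Type*}
  [∀ t, NormedAddCommGroup (E t)] [∀ t, InnerProductSpace ℝ (E t)]
  [NormedAddCommGroup Y] [InnerProductSpace ℝ Y]
  [∀ t, FiniteDimensional ℝ (E t)] [FiniteDimensional ℝ Y]
  {P : Problem E Y} {W : Moduli E} {S : Params}

/-- The residual `v` of a sweep from `y` to `x`. -/
def sweepRes (P : Problem E Y) (S : Params) (c : ℝ) (y x : PiLp 2 E) : PiLp 2 E :=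
  WithLp.toLp 2 fun t =>
    (P.grad x t - P.grad (glue t x (x t) y) t)
    + c • ContinuousLinearMap.adjoint (P.A t) (∑ s ∈ Finset.Ioi t, P.A s (x s - y s))
    - (1 / S.lam) • (x t - y t)

lemma vIter_succ (P : Problem E Y) (S : Params) (c : ℝ) (x : ℕ → PiLp 2 E) (k : ℕ) :
    P.vIter S c x (k + 1) = P.sweepRes S c (x k) (x (k + 1)) := rfl

lemma adjoint_opA_apply (P : Problem E Y) (q : Y) (t : Fin B) :
    ContinuousLinearMap.adjoint P.opA q t = ContinuousLinearMap.adjoint (P.A t) q := by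
  apply ext_inner_right ℝ
  intro w
  rw [← inner_single_right t _ w, ContinuousLinearMap.adjoint_inner_left, opA_single,
    ContinuousLinearMap.adjoint_inner_left]

lemma feas_glue (P : Problem E Y) (t : Fin B) (x y : PiLp 2 E) :
    P.feas (glue t x (x t) y) = P.feas x - ∑ s ∈ Finset.Ioi t, P.A s (x s - y s) := by
  have h : ∑ s ∈ Finset.Ioi t, P.A s (x s - y s)
      = ∑ s, (P.A s (x s) - P.A s (glue t x (x t) y s)) := by
    rw [← Finset.sum_subset (Finset.subset_univ (Finset.Ioi t))]
    · apply Finset.sum_congr rfl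
      intro s hs
      rw [glue_gt _ _ _ (Finset.mem_Ioi.1 hs), map_sub]
    · intro s _ hs
      rcases lt_or_eq_of_le (not_lt.1 (fun h => hs (Finset.mem_Ioi.2 h))) with h | rfl
      · rw [glue_lt _ _ _ h, sub_self]
      · rw [glue_same, sub_self]
  rw [h, feas, feas, opA_apply, opA_apply, Finset.sum_sub_distrib]
  abel

/-- The decrease of the Lagrangian guaranteed by a sweep, after absorbing the multiplier update. -/
def decrease (P : Problem E Y) (S : Params) (c : ℝ) (y x : PiLp 2 E) : ℝ :=
  3 / (4 * S.lam) * ‖x - y‖ ^ 2 + c / 4 * ∑ t, ‖P.A t (x t - y t)‖ ^ 2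

namespace Assumptions

lemma lagrR_sweep_le (hP : P.Assumptions W) (hS : S.Admissible B W.mMax) {c : ℝ} {p : Y}
    {y x : PiLp 2 E} (hy : y ∈ P.dom) (h : P.IsSweep S c p y x) :
    P.lagrR S.θ c x p + (3 / (4 * S.lam) * ‖x - y‖ ^ 2
      + c / 2 * ∑ t, ‖P.A t (x t - y t)‖ ^ 2) ≤ P.lagrR S.θ c y p := by
  have hlam := hS.lam_pos
  -- The point with its first `n` blocks updated: the block inequalities telescope from `mix 0 = y`
  -- to `mix B = x`.
  let mix : ℕ → PiLp 2 E := fun n => WithLp.toLp 2 fun s : Fin B => if s.val < n then x s else y s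
  have hmix1 : ∀ t : Fin B, glue t x (x t) y = mix (t.val + 1) := by
    intro t
    ext s
    rcases lt_trichotomy s t with hs | rfl | hs
    · have : s.val < t.val := hs
      rw [glue_lt _ _ _ hs]; simp [mix, this.trans (Nat.lt_succ_self _)]
    · simp [mix]
    · have : ¬ s.val < t.val + 1 := by have : t.val < s.val := hs; omega
      rw [glue_gt _ _ _ hs]; simp [mix, this]
  have hmix0 : ∀ t : Fin B, glue t x (y t) y = mix t.val := by
    intro t
    ext s
    rcases lt_trichotomy s t with hs | rfl | hs
    · have : s.val < t.val := hs
      rw [glue_lt _ _ _ hs]; simp [mix, this]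
    · simp [mix]
    · have : ¬ s.val < t.val := by have : t.val < s.val := hs; omega
      rw [glue_gt _ _ _ hs]; simp [mix, this]
  have hstep : ∀ t : Fin B, 3 / (4 * S.lam) * ‖(x - y) t‖ ^ 2 + c / 2 * ‖P.A t (x t - y t)‖ ^ 2
      ≤ P.lagrR S.θ c (mix t.val) p - P.lagrR S.θ c (mix (t.val + 1)) p := by
    intro t
    have h1 := hP.blockObj_growth hS c p (fun s _ => (h s).1) hy (h t).1 (hy t) (h t).2
    rw [blockObj, blockObj, hmix1, hmix0, sub_self, norm_zero] at h1
    -- The coefficient `3/4` is `1/2` from the prox term, which vanishes at the old block, plus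
    -- `1/4` from quadratic growth.
    have h2 : S.lam * (3 / (4 * S.lam) * ‖(x - y) t‖ ^ 2 + c / 2 * ‖P.A t (x t - y t)‖ ^ 2)
        ≤ S.lam * (P.lagrR S.θ c (mix t.val) p - P.lagrR S.θ c (mix (t.val + 1)) p) := by
      have h3 : S.lam * (3 / (4 * S.lam) * ‖(x - y) t‖ ^ 2) = 3 / 4 * ‖x t - y t‖ ^ 2 := by
        rw [PiLp.sub_apply]
        field_simp
      rw [mul_add, h3]
      linarith
    exact le_of_mul_le_mul_left h2 hlam
  have hsum := Finset.sum_le_sum fun t (_ : t ∈ Finset.univ) => hstep t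
  rw [Fin.sum_univ_eq_sum_range
    (fun n => P.lagrR S.θ c (mix n) p - P.lagrR S.θ c (mix (n + 1)) p) B,
    Finset.sum_range_sub', Finset.sum_add_distrib, ← Finset.mul_sum, ← Finset.mul_sum,
    ← PiLp.norm_sq_eq_of_L2] at hsum
  have h0 : mix 0 = y := by ext s; simp [mix]
  have hB : mix B = x := by ext s; simp [mix]
  rw [h0, hB] at hsum
  linarith

lemma MMax_nonneg (hP : P.Assumptions W) : 0 ≤ W.MMax :=
  (hP.M_nonneg ⟨0, hP.blocks_pos⟩).trans (le_MMax W _)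

lemma κ5_nonneg (hP : P.Assumptions W) : 0 ≤ P.κ5 := by
  have : (1 : ℝ) ≤ B := by exact_mod_cast hP.blocks_pos
  unfold κ5
  have : (0 : ℝ) ≤ B - 1 := by linarith
  positivity

/-- The residual of a sweep is controlled by the decrease. -/
lemma sq_norm_sweepRes_le (hP : P.Assumptions W) (hS : S.Admissible B W.mMax) {c : ℝ} (hc : 0 ≤ c)
    {y x : PiLp 2 E} (hy : y ∈ P.dom) (hx : x ∈ P.dom) :
    ‖P.sweepRes S c y x‖ ^ 2 ≤ (P.κ0 W S ^ 2 + P.κ5 * c) * P.decrease S c y x := by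
  have hlam := hS.lam_pos
  have hB1 : (1 : ℝ) ≤ B := by exact_mod_cast hP.blocks_pos
  have hM := hP.MMax_nonneg
  set a := ‖x - y‖ with ha
  set b2 := ∑ t, ‖P.A t (x t - y t)‖ ^ 2 with hb2
  have ha0 : 0 ≤ a := norm_nonneg _
  have hb0 : 0 ≤ b2 := Finset.sum_nonneg fun _ _ => sq_nonneg _
  -- Cauchy–Schwarz over the at most `B - 1` later blocks; this is the factor `B - 1` in `κ5`.
  have htail : ∀ t : Fin B, ‖∑ s ∈ Finset.Ioi t, P.A s (x s - y s)‖
      ≤ Real.sqrt (((B : ℝ) - 1) * b2) := by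
    intro t
    refine (norm_sum_le _ _).trans (Real.le_sqrt_of_sq_le ?_)
    refine sq_sum_le_card_mul_sum_sq.trans ?_
    have h1 : ((Finset.Ioi t).card : ℝ) ≤ (B : ℝ) - 1 := by
      have h3 : (Finset.Ioi t).card + 1 ≤ B := by
        have := t.isLt
        rw [Fin.card_Ioi]
        omega
      have h4 : ((Finset.Ioi t).card : ℝ) + 1 ≤ B := by exact_mod_cast h3
      linarith
    have h2 : ∑ s ∈ Finset.Ioi t, ‖P.A s (x s - y s)‖ ^ 2 ≤ b2 :=
      Finset.sum_le_sum_of_subset_of_nonneg (Finset.subset_univ _) fun _ _ _ => sq_nonneg _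
    exact mul_le_mul h1 h2 (Finset.sum_nonneg fun _ _ => sq_nonneg _) (by linarith)
  have hblock : ∀ t, ‖P.sweepRes S c y x t‖ ≤
      (W.MMax + 1 / S.lam) * a + c * Real.sqrt (((B : ℝ) - 1) * b2) * ‖P.A t‖ := by
    intro t
    have h1 : ‖P.grad x t - P.grad (glue t x (x t) y) t‖ ≤ W.MMax * a := by
      rw [norm_sub_rev]
      refine (hP.grad_lip t x hx y hy).trans ?_
      have := normGT_le_norm t (y - x)
      rw [norm_sub_rev] at this
      exact mul_le_mul (le_MMax W t) this (Real.sqrt_nonneg _) hM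
    have h2 : ‖c • ContinuousLinearMap.adjoint (P.A t)
        (∑ s ∈ Finset.Ioi t, P.A s (x s - y s))‖
        ≤ c * Real.sqrt (((B : ℝ) - 1) * b2) * ‖P.A t‖ := by
      rw [norm_smul, Real.norm_of_nonneg hc, mul_assoc]
      refine mul_le_mul_of_nonneg_left ?_ hc
      refine (ContinuousLinearMap.le_opNorm _ _).trans ?_
      rw [LinearIsometryEquiv.norm_map, mul_comm]
      exact mul_le_mul_of_nonneg_right (htail t) (norm_nonneg _)
    have h3 : ‖(1 / S.lam) • (x t - y t)‖ ≤ 1 / S.lam * a := by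
      rw [norm_smul, Real.norm_of_nonneg (by positivity)]
      exact mul_le_mul_of_nonneg_left (pilp_norm_apply_le (x - y) t) (by positivity)
    have h4 : P.sweepRes S c y x t = (P.grad x t - P.grad (glue t x (x t) y) t)
        + c • ContinuousLinearMap.adjoint (P.A t) (∑ s ∈ Finset.Ioi t, P.A s (x s - y s))
        - (1 / S.lam) • (x t - y t) := rfl
    rw [h4]
    refine (norm_sub_le _ _).trans ?_
    have := norm_add_le (P.grad x t - P.grad (glue t x (x t) y) t)
      (c • ContinuousLinearMap.adjoint (P.A t) (∑ s ∈ Finset.Ioi t, P.A s (x s - y s)))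
    linarith
  have hnorm : ‖P.sweepRes S c y x‖ ≤ B * ((W.MMax + 1 / S.lam) * a)
      + c * Real.sqrt (((B : ℝ) - 1) * b2) * P.normADag := by
    refine (pilp_norm_le_sum _).trans ((Finset.sum_le_sum fun t _ => hblock t).trans ?_)
    rw [Finset.sum_add_distrib, Finset.sum_const, Finset.card_univ,
      Fintype.card_fin, nsmul_eq_mul, normADag, ← Finset.mul_sum]
  have hsq : ‖P.sweepRes S c y x‖ ^ 2 ≤ 2 * (B * ((W.MMax + 1 / S.lam) * a)) ^ 2
      + 2 * (c * Real.sqrt (((B : ℝ) - 1) * b2) * P.normADag) ^ 2 := by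
    refine (pow_le_pow_left₀ (norm_nonneg _) hnorm 2).trans ?_
    nlinarith [sq_nonneg (B * ((W.MMax + 1 / S.lam) * a)
      - c * Real.sqrt (((B : ℝ) - 1) * b2) * P.normADag)]
  -- After simplification this compares `2B²` with `3B⁴`, so `κ0` is not tight here.
  have hfirst : 2 * (B * ((W.MMax + 1 / S.lam) * a)) ^ 2
      ≤ P.κ0 W S ^ 2 * (3 / (4 * S.lam) * a ^ 2) := by
    have h1 : P.κ0 W S ^ 2 = 4 * (B : ℝ) ^ 4 * (S.lam * W.MMax + 1) ^ 2 / S.lam := by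
      rw [κ0, div_pow, Real.sq_sqrt hlam.le]
      ring
    have h2 : 2 * (B * ((W.MMax + 1 / S.lam) * a)) ^ 2
        = 2 * (B : ℝ) ^ 2 * ((S.lam * W.MMax + 1) ^ 2 / S.lam ^ 2 * a ^ 2) := by
      field_simp
    have h3 : P.κ0 W S ^ 2 * (3 / (4 * S.lam) * a ^ 2)
        = 3 * (B : ℝ) ^ 4 * ((S.lam * W.MMax + 1) ^ 2 / S.lam ^ 2 * a ^ 2) := by
      rw [h1]
      field_simp
    rw [h2, h3]
    apply mul_le_mul_of_nonneg_right _ (by positivity)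
    have h4 : (1 : ℝ) ≤ (B : ℝ) ^ 2 := one_le_pow₀ hB1
    nlinarith
  -- An equality: the `8` in `κ5` is the `2` from squaring a sum times the `4` from the coefficient
  -- `c/4` in `decrease`.
  have hsecond : 2 * (c * Real.sqrt (((B : ℝ) - 1) * b2) * P.normADag) ^ 2
      = P.κ5 * c * (c / 4 * b2) := by
    rw [mul_pow, mul_pow, Real.sq_sqrt (mul_nonneg (by linarith) hb0), κ5]
    ring
  have hκ5 := hP.κ5_nonneg
  have hc1 : 0 ≤ P.κ5 * c * (3 / (4 * S.lam) * a ^ 2) := by positivity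
  have hc2 : 0 ≤ P.κ0 W S ^ 2 * (c / 4 * b2) := by positivity
  rw [decrease, ← ha, ← hb2]
  nlinarith

/-- First-order optimality of one block. -/
lemma sweep_block_optimality (hP : P.Assumptions W) (hS : S.Admissible B W.mMax) {c : ℝ} {p : Y}
    {y x : PiLp 2 E} (hy : y ∈ P.dom) (h : P.IsSweep S c p y x) (t : Fin B) {u : E t}
    (hu : u ∈ P.domBlock t) :
    (P.h t (x t)).toReal - inner ℝ (P.grad (glue t x (x t) y) t
      + ContinuousLinearMap.adjoint (P.A t) ((1 - S.θ) • p + c • P.feas (glue t x (x t) y))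
      + (1 / S.lam) • (x t - y t)) (u - x t) ≤ (P.h t u).toReal := by
  have hlam := hS.lam_pos
  have hxs : ∀ s < t, x s ∈ P.domBlock s := fun s _ => (h s).1
  set z := glue t x (x t) y with hz
  have hzd : z ∈ P.dom := glue_mem_dom hxs (h t).1 hy
  set w := u - x t with hw
  set Fz := P.feas z with hFz
  have hcurve : ∀ s : ℝ, glue t x ((1 - s) • x t + s • u) y = z + s • PiLp.single 2 t w := by
    intro s
    rw [glue_eq_add_single t x (x t)]
    have : (1 - s) • x t + s • u - x t = s • w := by rw [hw]; module
    rw [this]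
    congr 1
    ext r
    rcases eq_or_ne r t with rfl | hr
    · simp
    · simp [hr]
  have hfeas : ∀ s : ℝ, P.feas (z + s • PiLp.single 2 t w) = Fz + s • P.A t w := by
    intro s
    rw [hFz, feas, feas, map_add, map_smul, opA_single]
    abel
  set C1 : ℝ := S.lam * ((P.h t u).toReal - (P.h t (x t)).toReal)
    + S.lam * ((1 - S.θ) * inner ℝ p (P.A t w) + c * inner ℝ Fz (P.A t w))
    + inner ℝ (x t - y t) w with hC1
  set C2 : ℝ := S.lam * (c / 2 * ‖P.A t w‖ ^ 2) + 1 / 2 * ‖w‖ ^ 2 with hC2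
  -- An upper model of the block objective along the segment from `x t` to `u`, up to an additive
  -- constant: `h_t` is replaced by its chord, so `f` is the only part whose derivative is not
  -- explicit. The model is exact at `s = 0`, so it inherits the minimum there.
  let r : ℝ → ℝ := fun s => S.lam * P.f (z + s • PiLp.single 2 t w) + (s * C1 + s ^ 2 * C2)
  have hmem : ∀ s ∈ Set.Icc (0 : ℝ) 1, z + s • PiLp.single 2 t w ∈ P.dom := by
    intro s hs
    rw [← hcurve]
    exact glue_mem_dom hxs (hP.convex_domBlock t (h t).1 hu (by linarith [hs.2]) hs.1 (by ring)) hy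
  have hmin : ∀ s ∈ Set.Icc (0 : ℝ) 1, r 0 ≤ r s := by
    intro s hs
    have h1s : 0 ≤ 1 - s := by linarith [hs.2]
    have hus : (1 - s) • x t + s • u ∈ P.domBlock t :=
      hP.convex_domBlock t (h t).1 hu h1s hs.1 (by ring)
    have h1 := (h t).2 _ hus
    have hh : ∑ r, (P.h r (glue t x ((1 - s) • x t + s • u) y r)).toReal ≤
        ∑ r, (P.h r (z r)).toReal + s * ((P.h t u).toReal - (P.h t (x t)).toReal) := by
      have h2 : ∑ r, (P.h r (glue t x ((1 - s) • x t + s • u) y r)).toReal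
          - ∑ r, (P.h r (z r)).toReal
          = (P.h t ((1 - s) • x t + s • u)).toReal - (P.h t (x t)).toReal := by
        rw [← Finset.sum_sub_distrib, Finset.sum_eq_single t]
        · rw [hz, glue_same, glue_same]
        · intro r _ hr
          rcases lt_or_gt_of_ne hr with hr | hr
          · rw [hz, glue_lt _ _ _ hr, glue_lt _ _ _ hr, sub_self]
          · rw [hz, glue_gt _ _ _ hr, glue_gt _ _ _ hr, sub_self]
        · simp
      have h3 := (hP.h_convexOn t).2 (h t).1 hu h1s hs.1 (by ring)
      simp only [smul_eq_mul] at h3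
      linarith
    have hn : ‖(1 - s) • x t + s • u - y t‖ ^ 2
        = ‖x t - y t‖ ^ 2 + 2 * s * inner ℝ (x t - y t) w + s ^ 2 * ‖w‖ ^ 2 := by
      have : (1 - s) • x t + s • u - y t = (x t - y t) + s • w := by rw [hw]; module
      rw [this, norm_add_sq_real, inner_smul_right, norm_smul, mul_pow, Real.norm_eq_abs, sq_abs]
      ring
    have hq : ‖Fz + s • P.A t w‖ ^ 2
        = ‖Fz‖ ^ 2 + 2 * s * inner ℝ Fz (P.A t w) + s ^ 2 * ‖P.A t w‖ ^ 2 := by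
      rw [norm_add_sq_real, inner_smul_right, norm_smul, mul_pow, Real.norm_eq_abs, sq_abs]
      ring
    rw [blockObj, blockObj, lagrR, lagrR, phiR, phiR, hn] at h1
    have h4 := mul_le_mul_of_nonneg_left hh hlam.le
    rw [hcurve s] at h1 h4
    rw [hfeas, hq, inner_add_right, inner_smul_right, ← hz, ← hFz] at h1
    simp only [r, zero_smul, add_zero]
    rw [hC1, hC2]
    linarith
  have hderiv : HasDerivWithinAt r (S.lam * inner ℝ (P.grad z t) w + C1) (Set.Icc 0 1) 0 := by
    have h1 : HasDerivWithinAt (fun s : ℝ => z + s • (PiLp.single 2 t w : PiLp 2 E))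
        (PiLp.single 2 t w) (Set.Icc 0 1) 0 := by
      have := ((hasDerivAt_id (0 : ℝ)).smul_const (PiLp.single 2 t w : PiLp 2 E)).const_add z
      simpa using this.hasDerivWithinAt
    have h2 : HasFDerivWithinAt P.f (InnerProductSpace.toDual ℝ _ (P.grad z)) P.dom
        (z + (0 : ℝ) • (PiLp.single 2 t w : PiLp 2 E)) := by
      rw [zero_smul, add_zero]
      exact (hP.hasGradientWithinAt hzd).hasFDerivWithinAt
    have h3 := h2.comp_hasDerivWithinAt (0 : ℝ) h1 hmem
    rw [InnerProductSpace.toDual_apply_apply, inner_single_right] at h3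
    have h4 : HasDerivAt (fun s : ℝ => s * C1 + s ^ 2 * C2) C1 0 := by
      have := ((hasDerivAt_id (0 : ℝ)).mul_const C1).fun_add
        (((hasDerivAt_id (0 : ℝ)).pow 2).mul_const C2)
      simpa using this
    exact (h3.const_mul S.lam).add h4.hasDerivWithinAt
  have hnn := hasDerivWithinAt_nonneg_of_min hderiv hmin
  rw [inner_add_left, inner_add_left, ContinuousLinearMap.adjoint_inner_left, inner_add_left,
    real_inner_smul_left, real_inner_smul_left, real_inner_smul_left]
  have h5 : S.lam * ((P.h t (x t)).toReal - (inner ℝ (P.grad z t) w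
      + ((1 - S.θ) * inner ℝ p (P.A t w) + c * inner ℝ Fz (P.A t w))
      + 1 / S.lam * inner ℝ (x t - y t) w)) ≤ S.lam * (P.h t u).toReal := by
    have h6 : S.lam * (1 / S.lam * inner ℝ (x t - y t) w) = inner ℝ (x t - y t) w := by
      field_simp
    rw [hC1] at hnn
    rw [mul_sub, mul_add, h6]
    linarith
  exact le_of_mul_le_mul_left h5 hlam

/-- The residual of a sweep, shifted by the smooth part, is a subgradient of `h`. -/
lemma sweep_subgradient (hP : P.Assumptions W) (hS : S.Admissible B W.mMax) {c : ℝ} {p : Y}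
    {y x : PiLp 2 E} (hy : y ∈ P.dom) (h : P.IsSweep S c p y x) {z : PiLp 2 E} (hz : z ∈ P.dom) :
    ∑ t, (P.h t (x t)).toReal + inner ℝ (P.sweepRes S c y x - P.grad x
      - ContinuousLinearMap.adjoint P.opA ((1 - S.θ) • p + c • P.feas x)) (z - x)
      ≤ ∑ t, (P.h t (z t)).toReal := by
  rw [PiLp.inner_apply, ← Finset.sum_add_distrib]
  apply Finset.sum_le_sum
  intro t _
  have h1 := hP.sweep_block_optimality hS hy h t (hz t)
  rw [sub_eq_add_neg, ← inner_neg_left] at h1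
  -- Block optimality holds at the mixed point `(x_{≤t}, y_{>t})`. The gradient difference and the
  -- `c A_t^*` sum in the residual are the corrections that replace it by `x`.
  have h2 : (P.sweepRes S c y x - P.grad x
      - ContinuousLinearMap.adjoint P.opA ((1 - S.θ) • p + c • P.feas x)) t
      = -(P.grad (glue t x (x t) y) t
        + ContinuousLinearMap.adjoint (P.A t) ((1 - S.θ) • p + c • P.feas (glue t x (x t) y))
        + (1 / S.lam) • (x t - y t)) := by
    rw [PiLp.sub_apply, PiLp.sub_apply, adjoint_opA_apply, feas_glue]
    simp only [sweepRes, map_add, map_smul, map_sub, smul_sub]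
    abel
  rw [h2, PiLp.sub_apply]
  exact h1

lemma sweep_mem_subdiff (hP : P.Assumptions W) (hS : S.Admissible B W.mMax) {c : ℝ} {p : Y}
    {y x : PiLp 2 E} (hy : y ∈ P.dom) (h : P.IsSweep S c p y x) :
    P.sweepRes S c y x - P.grad x
      - ContinuousLinearMap.adjoint P.opA ((1 - S.θ) • p + c • P.feas x) ∈ subdiff P.hSum x := by
  intro z
  by_cases hz : z ∈ P.dom
  · rw [hP.hSum_coe h.mem_dom, hP.hSum_coe hz, ← EReal.coe_add, EReal.coe_le_coe_iff]
    exact hP.sweep_subgradient hS hy h hz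
  · rw [hP.hSum_top hz]
    exact le_top

lemma isStationaryPair_of_sweep (hP : P.Assumptions W) (hS : S.Admissible B W.mMax) {c ρ η : ℝ}
    {p : Y} {y x : PiLp 2 E} (hy : y ∈ P.dom) (h : P.IsSweep S c p y x)
    (hρ : ‖P.sweepRes S c y x‖ ≤ ρ) (hη : ‖P.feas x‖ ≤ η) :
    P.IsStationaryPair ρ η x ((1 - S.θ) • p + c • P.feas x) := by
  refine ⟨h.mem_dom, ?_, hη⟩
  refine (Metric.infEDist_le_edist_of_mem
    (Set.mem_image_of_mem _ (hP.sweep_mem_subdiff hS hy h))).trans ?_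
  rw [edist_comm, edist_eq_enorm_sub, sub_zero]
  have h1 : P.grad x + ContinuousLinearMap.adjoint P.opA ((1 - S.θ) • p + c • P.feas x)
      + (P.sweepRes S c y x - P.grad x
        - ContinuousLinearMap.adjoint P.opA ((1 - S.θ) • p + c • P.feas x))
      = P.sweepRes S c y x := by abel
  rw [h1, ← ofReal_norm]
  exact ENNReal.ofReal_le_ofReal hρ

end Assumptions

end Problem

/-! ### The smallest positive singular value as a lower bound on the range. -/

section SingularValues

variable {X Y : Type*} [NormedAddCommGroup X] [InnerProductSpace ℝ X] [FiniteDimensional ℝ X]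
  [NormedAddCommGroup Y] [InnerProductSpace ℝ Y] [FiniteDimensional ℝ Y]

/-- The smallest positive singular value of a linear map. -/
def minPosSingularValue (T : X →ₗ[ℝ] Y) : ℝ := sInf {s : ℝ | 0 < s ∧ ∃ i, T.singularValues i = s}

lemma minPosSingularValue_pos {T : X →ₗ[ℝ] Y} (hT : T ≠ 0) : 0 < minPosSingularValue T := by
  have hfin : {s : ℝ | 0 < s ∧ ∃ i, T.singularValues i = s}.Finite := by
    refine (T.singularValues.support.finite_toSet.image T.singularValues).subset ?_
    rintro s ⟨hs, i, rfl⟩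
    exact ⟨i, Finsupp.mem_support_iff.2 hs.ne', rfl⟩
  have hne : {s : ℝ | 0 < s ∧ ∃ i, T.singularValues i = s}.Nonempty := by
    refine ⟨T.singularValues 0, ?_, 0, rfl⟩
    rw [T.singularValues_pos_iff_lt_finrank_range, Nat.pos_iff_ne_zero]
    intro h
    exact hT (LinearMap.range_eq_bot.1 (Submodule.finrank_eq_zero.1 h))
  exact (hne.csInf_mem hfin).1

lemma minPosSingularValue_le {T : X →ₗ[ℝ] Y} {i : ℕ} (hi : 0 < T.singularValues i) :
    minPosSingularValue T ≤ T.singularValues i :=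
  csInf_le ⟨0, fun _ hs => hs.1.le⟩ ⟨hi, i, rfl⟩

/-- In an eigenbasis of `T^*T` both sides are sums over coordinates; those with zero singular value
contribute to neither, and the others have singular value at least the minimum. -/
lemma minPosSingularValue_mul_norm_le {T : X →ₗ[ℝ] Y} (hT : T ≠ 0) (w : X) :
    minPosSingularValue T * ‖T w‖ ≤ ‖LinearMap.adjoint T (T w)‖ := by
  have hσ := minPosSingularValue_pos hT
  have hsym := T.isSymmetric_adjoint_comp_self
  let e := hsym.eigenvectorBasis rfl
  have h1 : ‖T w‖ ^ 2 = ∑ i : Fin (Module.finrank ℝ X), T.singularValues i ^ 2 * (e.repr w i) ^ 2 := by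
    rw [← real_inner_self_eq_norm_sq, ← LinearMap.adjoint_inner_left,
      ← LinearMap.comp_apply, ← e.repr.inner_map_map, PiLp.inner_apply]
    refine Finset.sum_congr rfl fun i _ => ?_
    rw [hsym.eigenvectorBasis_apply_self_apply, T.sq_singularValues_fin rfl]
    simp [e]
    ring
  have h2 : ‖LinearMap.adjoint T (T w)‖ ^ 2
      = ∑ i : Fin (Module.finrank ℝ X), (T.singularValues i ^ 2 * e.repr w i) ^ 2 := by
    rw [← LinearMap.comp_apply, ← e.repr.norm_map, PiLp.norm_sq_eq_of_L2]
    refine Finset.sum_congr rfl fun i _ => ?_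
    rw [hsym.eigenvectorBasis_apply_self_apply, T.sq_singularValues_fin rfl, Real.norm_eq_abs,
      sq_abs]
    simp [e]
  apply le_of_sq_le_sq _ (norm_nonneg _)
  rw [mul_pow, h1, h2, Finset.mul_sum]
  refine Finset.sum_le_sum fun i _ => ?_
  rcases (T.singularValues_nonneg i).eq_or_lt with h | h
  · simp [← h]
  · have h3 := pow_le_pow_left₀ hσ.le (minPosSingularValue_le h) 2
    have h4 : 0 ≤ T.singularValues i ^ 2 * (e.repr w i) ^ 2 := by positivity
    calc _ ≤ T.singularValues i ^ 2 * (T.singularValues i ^ 2 * (e.repr w i) ^ 2) :=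
          mul_le_mul_of_nonneg_right h3 h4
      _ = _ := by ring

end SingularValues

/-! ### The Slater point and the recursion for the multipliers. -/

namespace Problem

variable {B : ℕ} {E : Fin B → Type*} {Y : Type*}
  [∀ t, NormedAddCommGroup (E t)] [∀ t, InnerProductSpace ℝ (E t)]
  [NormedAddCommGroup Y] [InnerProductSpace ℝ Y]
  [∀ t, FiniteDimensional ℝ (E t)] [FiniteDimensional ℝ Y]
  {P : Problem E Y} {W : Moduli E} {S : Params}

namespace Assumptions

lemma toLinearMap_opA_ne (hP : P.Assumptions W) : P.opA.toLinearMap ≠ 0 := by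
  intro h
  apply hP.A_ne
  ext x
  exact LinearMap.congr_fun h x

lemma sigmaPlus_pos (hP : P.Assumptions W) : 0 < P.sigmaPlus :=
  minPosSingularValue_pos hP.toLinearMap_opA_ne

lemma sigmaPlus_mul_norm_le (hP : P.Assumptions W) {q : Y} (hq : q ∈ Set.range P.opA) :
    P.sigmaPlus * ‖q‖ ≤ ‖ContinuousLinearMap.adjoint P.opA q‖ := by
  obtain ⟨w, rfl⟩ := hq
  have h := minPosSingularValue_mul_norm_le hP.toLinearMap_opA_ne w
  have h2 : LinearMap.adjoint P.opA.toLinearMap (P.opA.toLinearMap w)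
      = ContinuousLinearMap.adjoint P.opA (P.opA w) := by
    apply ext_inner_right ℝ
    intro z
    rw [LinearMap.adjoint_inner_left, ContinuousLinearMap.adjoint_inner_left]
    rfl
  rw [h2] at h
  exact h

lemma dDag_pos (hP : P.Assumptions W) : 0 < P.dDag W := hP.z_dist

lemma norm_sub_zdag_le (hP : P.Assumptions W) {z : PiLp 2 E} (hz : z ∈ P.dom) :
    ‖z - W.zdag‖ ≤ P.DDag W :=
  le_csSup (hP.isCompact_dom.image (f := fun z => ‖z - W.zdag‖) (by fun_prop)).bddAbove
    ⟨z, hz, rfl⟩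

/-- Since `A ≠ 0` there is a nonzero direction, and the ball around the Slater point leaves room to
move along it. Positivity matters because `κ4` divides by `D_†`. -/
lemma DDag_pos (hP : P.Assumptions W) : 0 < P.DDag W := by
  obtain ⟨w, hw⟩ : ∃ w, P.opA w ≠ 0 := by
    by_contra h
    push Not at h
    exact hP.A_ne (ContinuousLinearMap.ext h)
  have hw0 : 0 < ‖w‖ := norm_pos_iff.2 fun h => hw (by rw [h, map_zero])
  have hd := hP.dDag_pos
  set z := W.zdag + (P.dDag W / 2 / ‖w‖) • w with hz
  have hn : ‖z - W.zdag‖ = P.dDag W / 2 := by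
    rw [hz, add_sub_cancel_left, norm_smul, Real.norm_of_nonneg (by positivity)]
    field_simp
  have hmem : z ∈ P.dom := by
    apply hP.ball_subset_dom
    rw [Metric.mem_ball, dist_eq_norm, hn]
    linarith
  have := hP.norm_sub_zdag_le hmem
  linarith

lemma norm_grad_le (hP : P.Assumptions W) {x : PiLp 2 E} (hx : x ∈ P.dom) : ‖P.grad x‖ ≤ P.Gf :=
  le_csSup hP.grad_bdd ⟨x, hx, rfl⟩

lemma Gf_nonneg (hP : P.Assumptions W) : 0 ≤ P.Gf :=
  (norm_nonneg _).trans (hP.norm_grad_le hP.z_mem)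

lemma phiR_sub_le (hP : P.Assumptions W) {x y : PiLp 2 E} (hx : x ∈ P.dom) (hy : y ∈ P.dom) :
    P.phiR x - P.phiR y ≤ P.deltaPhi := by
  have himg : (fun x => (P.phi x).toReal) '' P.dom = P.phiR '' P.dom := by
    apply Set.image_congr
    intro z hz
    rw [hP.phi_coe hz, EReal.toReal_coe]
  have hc := hP.isCompact_dom.image_of_continuousOn hP.continuousOn_phiR
  rw [deltaPhi, himg]
  exact sub_le_sub (le_csSup hc.bddAbove ⟨x, hx, rfl⟩) (csInf_le hc.bddBelow ⟨y, hy, rfl⟩)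

lemma deltaPhi_nonneg (hP : P.Assumptions W) : 0 ≤ P.deltaPhi := by
  simpa using hP.phiR_sub_le hP.z_mem hP.z_mem

lemma feas_eq (hP : P.Assumptions W) (x : PiLp 2 E) : P.feas x = P.opA (x - W.zdag) := by
  rw [feas, map_sub, hP.z_feas]

lemma norm_feas_le (hP : P.Assumptions W) {x : PiLp 2 E} (hx : x ∈ P.dom) :
    ‖P.feas x‖ ≤ ‖P.opA‖ * P.DDag W := by
  rw [hP.feas_eq]
  exact (P.opA.le_opNorm _).trans
    (mul_le_mul_of_nonneg_left (hP.norm_sub_zdag_le hx) (norm_nonneg _))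

lemma κ4_pos (hP : P.Assumptions W) (hS : S.Admissible B W.mMax) : 0 < P.κ4 W S := by
  have := hP.dDag_pos
  have := hP.DDag_pos
  have := hP.sigmaPlus_pos
  have := hS.chi_pos
  have := hS.theta_pos
  unfold κ4
  positivity

/-- The Slater point bounds the multiplier of a sweep. -/
lemma slater_bound (hP : P.Assumptions W) (hS : S.Admissible B W.mMax) {c : ℝ} {p : Y}
    {y x : PiLp 2 E} (hy : y ∈ P.dom) (h : P.IsSweep S c p y x)
    (hq : (1 - S.θ) • p + c • P.feas x ∈ Set.range P.opA) :
    P.dDag W * (P.sigmaPlus * ‖(1 - S.θ) • p + c • P.feas x‖)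
      + inner ℝ ((1 - S.θ) • p + c • P.feas x) (P.feas x)
      ≤ 2 * P.DDag W * (W.Kh + P.Gf + ‖P.sweepRes S c y x‖) := by
  have hxd := h.mem_dom
  have hd := hP.dDag_pos
  have hsub : ∀ z ∈ P.dom, _ := fun z hz => hP.sweep_subgradient hS hy h (z := z) hz
  set q := (1 - S.θ) • p + c • P.feas x with hqdef
  set v := P.sweepRes S c y x
  set g := ContinuousLinearMap.adjoint P.opA q with hg
  have key : ∀ δ : ℝ, 0 < δ → δ < P.dDag W →
      δ * ‖g‖ + inner ℝ q (P.feas x) ≤ 2 * P.DDag W * (W.Kh + P.Gf + ‖v‖) := by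
    intro δ hδ hδd
    -- Moving from the Slater point against `g = A^*q` makes `⟨g, z - x⟩` equal to `-⟨q, Ax - d⟩ -
    -- δ‖g‖`, which brings `‖A^*q‖` into the subgradient inequality. For `g = 0` this is the Slater
    -- point itself.
    set z := W.zdag - (δ / ‖g‖) • g with hz
    have hzn : ‖z - W.zdag‖ ≤ δ := by
      rw [hz, sub_sub_cancel_left, norm_neg, norm_smul, Real.norm_of_nonneg (by positivity)]
      rcases eq_or_ne ‖g‖ 0 with h0 | h0
      · rw [h0, mul_zero]; exact hδ.le
      · rw [div_mul_cancel₀ _ h0]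
    have hzd : z ∈ P.dom := by
      apply hP.ball_subset_dom
      rw [Metric.mem_ball, dist_eq_norm]
      exact hzn.trans_lt hδd
    have h1 := hsub z hzd
    have h2 := hP.h_lip z hzd x hxd
    rw [hP.hSum_coe hzd, hP.hSum_coe hxd, EReal.toReal_coe, EReal.toReal_coe] at h2
    have h3 := (abs_le.1 h2).2
    have hg1 : inner ℝ g (z - x) = - inner ℝ q (P.feas x) - δ * ‖g‖ := by
      have e1 : z - x = -(x - W.zdag) - (δ / ‖g‖) • g := by rw [hz]; abel
      have e2 : inner ℝ g (x - W.zdag) = inner ℝ q (P.feas x) := by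
        rw [hg, ContinuousLinearMap.adjoint_inner_left, hP.feas_eq]
      rw [e1, inner_sub_right, inner_neg_right, e2, inner_smul_right, real_inner_self_eq_norm_sq]
      rcases eq_or_ne ‖g‖ 0 with h0 | h0
      · rw [h0]; ring
      · field_simp
    rw [inner_sub_left, inner_sub_left, hg1] at h1
    have h4 := (abs_le.1 (abs_real_inner_le_norm v (z - x))).1
    have h5 := (abs_le.1 (abs_real_inner_le_norm (P.grad x) (z - x))).2
    have h6 : ‖z - x‖ ≤ 2 * P.DDag W := by
      have e1 : z - x = (z - W.zdag) - (x - W.zdag) := by abel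
      rw [e1]
      refine (norm_sub_le _ _).trans ?_
      linarith [hP.norm_sub_zdag_le hzd, hP.norm_sub_zdag_le hxd]
    have h7 : ‖P.grad x‖ * ‖z - x‖ ≤ P.Gf * ‖z - x‖ :=
      mul_le_mul_of_nonneg_right (hP.norm_grad_le hxd) (norm_nonneg _)
    have h8 : (W.Kh + P.Gf + ‖v‖) * ‖z - x‖ ≤ (W.Kh + P.Gf + ‖v‖) * (2 * P.DDag W) :=
      mul_le_mul_of_nonneg_left h6
        (add_nonneg (add_nonneg hP.Kh_nonneg hP.Gf_nonneg) (norm_nonneg _))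
    linarith
  -- Only the open ball is known to lie in the domain, so the radius `d_†` is reached as a limit.
  have hlim : Filter.Tendsto (fun δ : ℝ => δ * ‖g‖ + inner ℝ q (P.feas x))
      (nhdsWithin (P.dDag W) (Set.Iio (P.dDag W)))
      (nhds (P.dDag W * ‖g‖ + inner ℝ q (P.feas x))) := by
    have : Continuous fun δ : ℝ => δ * ‖g‖ + inner ℝ q (P.feas x) := by fun_prop
    exact (this.tendsto _).mono_left nhdsWithin_le_nhds
  have h1 := le_of_tendsto hlim (b := 2 * P.DDag W * (W.Kh + P.Gf + ‖v‖))
    (by filter_upwards [Ioo_mem_nhdsLT hd] with δ hδ using key δ hδ.1 hδ.2)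
  have h2 := mul_le_mul_of_nonneg_left (hP.sigmaPlus_mul_norm_le hq) hd.le
  linarith

/-- One step of the recursion satisfied by the norms of the multipliers. -/
lemma norm_multiplier_le (hP : P.Assumptions W) (hS : S.Admissible B W.mMax) {c : ℝ} (hc : 0 < c)
    {p : Y} (hp : p ∈ Set.range P.opA) {y x : PiLp 2 E} (hy : y ∈ P.dom)
    (h : P.IsSweep S c p y x) :
    ‖(1 - S.θ) • p + (S.χ * c) • P.feas x‖ ≤ (1 - S.θ) * ‖p‖
      + 2 * S.θ / P.κ4 W S * (W.Kh + P.Gf + ‖P.sweepRes S c y x‖) := by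
  have hχ := hS.chi_pos
  have hχ1 := hS.chi_le
  have hθ := hS.theta_pos
  have hθ1 : 0 ≤ 1 - S.θ := by linarith [hS.theta_le]
  have hκ4 := hP.κ4_pos hS
  have hd := hP.dDag_pos
  have hD := hP.DDag_pos
  have hσ := hP.sigmaPlus_pos
  have hG : 0 ≤ W.Kh + P.Gf + ‖P.sweepRes S c y x‖ :=
    add_nonneg (add_nonneg hP.Kh_nonneg hP.Gf_nonneg) (norm_nonneg _)
  have hq : (1 - S.θ) • p + c • P.feas x ∈ Set.range P.opA := by
    obtain ⟨w, rfl⟩ := hp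
    refine ⟨(1 - S.θ) • w + c • (x - W.zdag), ?_⟩
    rw [map_add, map_smul, map_smul, ← hP.feas_eq]
  have hsl := hP.slater_bound hS hy h hq
  have hr : ‖(1 - S.θ) • p‖ = (1 - S.θ) * ‖p‖ := by rw [norm_smul, Real.norm_of_nonneg hθ1]
  rw [← hr]
  set r := (1 - S.θ) • p
  set F := P.feas x
  set G := W.Kh + P.Gf + ‖P.sweepRes S c y x‖
  clear_value r F G
  -- Either the update does not increase the norm of `r = (1-θ)p`, or `⟨q, Ax - d⟩ ≥ 0`. In the
  -- second case that inner product can be dropped from the Slater inequality, which then bounds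
  -- `‖q‖`.
  rcases le_or_gt ‖r + (S.χ * c) • F‖ ‖r‖ with hle | hgt
  · have : 0 ≤ 2 * S.θ / P.κ4 W S * G := by positivity
    linarith
  · have h1 : 0 ≤ inner ℝ (r + c • F) F := by
      have e1 : ‖r + (S.χ * c) • F‖ ^ 2
          = ‖r‖ ^ 2 + 2 * (S.χ * c) * inner ℝ r F + (S.χ * c) ^ 2 * ‖F‖ ^ 2 := by
        rw [norm_add_sq_real, inner_smul_right, norm_smul, mul_pow, Real.norm_eq_abs, sq_abs]
        ring
      have e2 : inner ℝ (r + c • F) F = inner ℝ r F + c * ‖F‖ ^ 2 := by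
        rw [inner_add_left, real_inner_smul_left, real_inner_self_eq_norm_sq]
      have e3 : ‖r‖ ^ 2 < ‖r + (S.χ * c) • F‖ ^ 2 :=
        pow_lt_pow_left₀ hgt (norm_nonneg _) two_ne_zero
      have e4 : 0 < S.χ * c := by positivity
      have e5 : 0 ≤ S.χ * c * ((2 - S.χ) * (c * ‖F‖ ^ 2)) := by
        have : 0 ≤ 2 - S.χ := by linarith
        positivity
      have e6 : 0 ≤ S.χ * c * (2 * inner ℝ (r + c • F) F) := by
        rw [e2]
        nlinarith
      have := nonneg_of_mul_nonneg_right e6 e4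
      linarith
    have h2 : P.dDag W * P.sigmaPlus * ‖r + c • F‖ ≤ 2 * P.DDag W * G := by linarith
    -- The new multiplier is the convex combination `(1-χ)r + χq`, as `q = r + cF`.
    have h3 : ‖r + (S.χ * c) • F‖ ≤ ‖r‖ + S.χ * ‖r + c • F‖ := by
      have e1 : r + (S.χ * c) • F = (1 - S.χ) • r + S.χ • (r + c • F) := by module
      rw [e1]
      refine (norm_add_le _ _).trans ?_
      rw [norm_smul, norm_smul, Real.norm_of_nonneg hχ.le,
        Real.norm_of_nonneg (by linarith : 0 ≤ 1 - S.χ)]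
      nlinarith [norm_nonneg r]
    have h4 : S.χ * ‖r + c • F‖ ≤ 2 * S.θ / P.κ4 W S * G := by
      have e1 : 2 * S.θ / P.κ4 W S * G
          = S.χ * (2 * P.DDag W * G / (P.dDag W * P.sigmaPlus)) := by
        rw [κ4]
        field_simp
      rw [e1]
      apply mul_le_mul_of_nonneg_left _ hχ.le
      rw [le_div_iff₀ (by positivity)]
      linarith
    linarith

end Assumptions

end Problem

/-- Scalar relations between the norms `a` of the multipliers, the norms `r` of the residuals and
a potential `Ψ` along a run. -/
structure MultiplierRecursion (a r Ψ : ℕ → ℝ) (κ κ₄ θ G U Δ w : ℝ) : Prop where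
  κ_nonneg : 0 ≤ κ
  κ₄_pos : 0 < κ₄
  θ_pos : 0 < θ
  θ_le : θ ≤ 1
  G_nonneg : 0 ≤ G
  w_nonneg : 0 ≤ w
  Δ_nonneg : 0 ≤ Δ
  a_nonneg : ∀ k, 0 ≤ a k
  a_le : ∀ k, a k ≤ U
  a_rec : ∀ k, a (k + 1) ≤ (1 - θ) * a k + 2 * θ / κ₄ * (G + r (k + 1))
  r_sq : ∀ k, r (k + 2) ^ 2 ≤ κ * (Ψ (k + 1) - Ψ (k + 2))
  Ψ_anti : ∀ k, Ψ (k + 2) ≤ Ψ (k + 1)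
  Ψ_gap : ∀ j k s s', a j ≤ s → a (j + 1) ≤ s → a (k + 1) ≤ s' →
    Ψ (j + 1) - Ψ (k + 1) ≤ Δ + w * (5 * s ^ 2 + s' ^ 2)

/-! ### Averaging argument for the abstract recursion. -/

namespace MultiplierRecursion

variable {a r Ψ : ℕ → ℝ} {κ κ₄ θ G U Δ w : ℝ}

/-- A window length beyond which the averages of the multipliers are under control. -/
def threshold (κ κ₄ θ U Δ w : ℝ) : ℝ := 8 / κ₄ ^ 2 * (κ * (Δ + 9 * (w * U ^ 2))) + (1 - θ) * U

/-- The bound on the averages of the multipliers. -/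
def meanBound (κ₄ θ G : ℝ) : ℝ := 1 / θ * (1 + 2 * G / κ₄) + 1

lemma sum_sq_le (H : MultiplierRecursion a r Ψ κ κ₄ θ G U Δ w) (j N : ℕ) :
    ∑ i ∈ Finset.range N, r (j + 2 + i) ^ 2 ≤ κ * (Ψ (j + 1) - Ψ (j + 1 + N)) := by
  induction N with
  | zero => simp
  | succ N ih =>
    rw [Finset.sum_range_succ]
    have h := H.r_sq (j + N)
    have e1 : j + N + 2 = j + 2 + N := by omega
    have e2 : j + N + 1 = j + 1 + N := by omega
    have e3 : j + 2 + N = j + 1 + (N + 1) := by omega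
    rw [e1, e2] at h
    rw [← e3]
    linarith

lemma potential_le (H : MultiplierRecursion a r Ψ κ κ₄ θ G U Δ w) (j N : ℕ) :
    Ψ (j + 1 + N) ≤ Ψ (j + 1) := by
  induction N with
  | zero => simp
  | succ N ih =>
    have h := H.Ψ_anti (j + N)
    have e1 : j + N + 2 = j + 1 + (N + 1) := by omega
    have e2 : j + N + 1 = j + 1 + N := by omega
    rw [e1, e2] at h
    exact h.trans ih

/-- Summing the contraction keeps a fraction `θ` of every term; only the initial term and the
forcing remain on the right. -/
lemma sum_rec_le (H : MultiplierRecursion a r Ψ κ κ₄ θ G U Δ w) (j N : ℕ) :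
    θ * ∑ i ∈ Finset.range N, a (j + 1 + i) + (1 - θ) * a (j + N)
      ≤ (1 - θ) * a j + 2 * θ / κ₄ * (N * G + ∑ i ∈ Finset.range N, r (j + 1 + i)) := by
  induction N with
  | zero => simp
  | succ N ih =>
    rw [Finset.sum_range_succ, Finset.sum_range_succ]
    have h := H.a_rec (j + N)
    have e1 : j + 1 + N = j + N + 1 := by omega
    rw [e1, ← add_assoc, Nat.cast_succ]
    linarith

lemma U_nonneg (H : MultiplierRecursion a r Ψ κ κ₄ θ G U Δ w) : 0 ≤ U :=
  (H.a_nonneg 0).trans (H.a_le 0)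

lemma meanBound_nonneg (H : MultiplierRecursion a r Ψ κ κ₄ θ G U Δ w) :
    0 ≤ meanBound κ₄ θ G := by
  have := H.θ_pos
  have := H.κ₄_pos
  have := H.G_nonneg
  unfold meanBound
  positivity

lemma sum_le_mul_of_sum_sq_le {N : ℕ} {g : ℕ → ℝ} {C : ℝ} (hC : 0 ≤ C)
    (h : ∑ i ∈ Finset.range N, g i ^ 2 ≤ N * C ^ 2) : ∑ i ∈ Finset.range N, g i ≤ N * C := by
  apply le_of_sq_le_sq _ (by positivity)
  have h1 := sq_sum_le_card_mul_sum_sq (s := Finset.range N) (f := g)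
  rw [Finset.card_range] at h1
  have h2 := mul_le_mul_of_nonneg_left h (Nat.cast_nonneg (α := ℝ) N)
  calc _ ≤ _ := h1
    _ ≤ _ := h2
    _ = _ := by ring

/-- Over long windows the average of the multipliers is bounded independently of `U`. -/
lemma window_sum_le (H : MultiplierRecursion a r Ψ κ κ₄ θ G U Δ w) (j N : ℕ)
    (hN : threshold κ κ₄ θ U Δ w ≤ N) :
    ∑ i ∈ Finset.range N, a (j + 2 + i) ≤ N * meanBound κ₄ θ G := by
  have hκ := H.κ_nonneg
  have hκ4 := H.κ₄_pos
  have hθ := H.θ_pos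
  have hU := H.U_nonneg
  have hθ1 : 0 ≤ 1 - θ := by linarith [H.θ_le]
  have hw := H.w_nonneg
  have hΔ := H.Δ_nonneg
  have hG := H.G_nonneg
  have hN1 : (1 - θ) * U ≤ N := by
    have : 0 ≤ 8 / κ₄ ^ 2 * (κ * (Δ + 9 * (w * U ^ 2))) := by positivity
    unfold threshold at hN
    linarith
  have hN2 : 8 / κ₄ ^ 2 * (κ * (Δ + 9 * (w * U ^ 2))) ≤ N := by
    have : 0 ≤ (1 - θ) * U := by positivity
    unfold threshold at hN
    linarith
  -- With the crude bound `U` at both ends, the choice of `threshold` brings the mean square of the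
  -- residuals down to `κ₄²/8`, hence their mean below `κ₄/2`.
  have hr : ∑ i ∈ Finset.range N, r (j + 2 + i) ≤ N * (κ₄ / 2) := by
    apply sum_le_mul_of_sum_sq_le (by positivity)
    refine (H.sum_sq_le j N).trans ?_
    have e1 : j + 1 + N = j + N + 1 := by omega
    have h1 := H.Ψ_gap j (j + N) U U (H.a_le _) (H.a_le _) (H.a_le _)
    rw [← e1] at h1
    have h2 : κ * (Ψ (j + 1) - Ψ (j + 1 + N)) ≤ κ * (Δ + 9 * (w * U ^ 2)) := by
      apply mul_le_mul_of_nonneg_left _ hκ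
      have : 0 ≤ w * U ^ 2 := by positivity
      linarith
    refine h2.trans ?_
    rw [div_mul_eq_mul_div, div_le_iff₀ (by positivity)] at hN2
    have h3 : 0 ≤ (N : ℝ) * κ₄ ^ 2 := by positivity
    nlinarith
  have h1 := H.sum_rec_le (j + 1) N
  -- The summand `(1-θ)U` of `threshold` spreads the initial term over the window, at a cost of at
  -- most `1` per index.
  have h2 : (1 - θ) * a (j + 1) ≤ N :=
    (mul_le_mul_of_nonneg_left (H.a_le _) hθ1).trans hN1
  have h3 : 0 ≤ (1 - θ) * a (j + 1 + N) := mul_nonneg hθ1 (H.a_nonneg _)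
  have e2 : j + 1 + 1 = j + 2 := rfl
  rw [e2] at h1
  have h4 : 2 * θ / κ₄ * (N * G + ∑ i ∈ Finset.range N, r (j + 2 + i))
      ≤ 2 * θ / κ₄ * (N * G + N * (κ₄ / 2)) :=
    mul_le_mul_of_nonneg_left (by linarith) (by positivity)
  have h5 : 2 * θ / κ₄ * (N * G + N * (κ₄ / 2)) = θ * (N * (2 * G / κ₄ + 1)) := by
    field_simp
  have h6 : θ * ∑ i ∈ Finset.range N, a (j + 2 + i) ≤ θ * (N * meanBound κ₄ θ G) := by
    have h7 : θ * (N * meanBound κ₄ θ G) = N * (1 + 2 * G / κ₄) + θ * N := by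
      unfold meanBound
      field_simp
    have h8 : θ * (N * (2 * G / κ₄ + 1)) ≤ N * (2 * G / κ₄) + θ * N := by
      have : 0 ≤ (N : ℝ) * (2 * G / κ₄) := by positivity
      nlinarith
    linarith
  exact le_of_mul_le_mul_left h6 hθ

lemma exists_le (H : MultiplierRecursion a r Ψ κ κ₄ θ G U Δ w) (j : ℕ) :
    ∃ i, a (j + 2 + i) ≤ meanBound κ₄ θ G := by
  obtain ⟨N, hN⟩ := exists_nat_ge (threshold κ κ₄ θ U Δ w)
  have h := H.window_sum_le j (N + 1) (by push_cast; linarith)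
  by_contra hcon
  push Not at hcon
  have h2 := Finset.sum_lt_sum_of_nonempty (s := Finset.range (N + 1)) (by simp)
    (fun i _ => hcon i)
  rw [Finset.sum_const, Finset.card_range, nsmul_eq_mul] at h2
  linarith

/-- Two adjacent small multipliers are needed because the upper bound on the potential involves the
current and the previous one. Averaging over two windows shifted by one produces such a pair. -/
lemma exists_pair_le (H : MultiplierRecursion a r Ψ κ κ₄ θ G U Δ w) {N : ℕ} (hN0 : 0 < N)
    (hN : threshold κ κ₄ θ U Δ w ≤ N) :
    ∃ i < N, a (2 + i) + a (2 + i + 1) ≤ 2 * meanBound κ₄ θ G := by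
  have h1 := H.window_sum_le 0 N hN
  have h2 := H.window_sum_le 1 N hN
  by_contra hcon
  push Not at hcon
  have h3 := Finset.sum_lt_sum_of_nonempty (s := Finset.range N) (by simpa using hN0.ne')
    (fun i hi => hcon i (Finset.mem_range.1 hi))
  rw [Finset.sum_const, Finset.card_range, nsmul_eq_mul, Finset.sum_add_distrib] at h3
  have h4 : ∑ i ∈ Finset.range N, a (2 + i + 1) = ∑ i ∈ Finset.range N, a (1 + 2 + i) :=
    Finset.sum_congr rfl fun i _ => by rw [show 2 + i + 1 = 1 + 2 + i by omega]
  rw [h4] at h3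
  simp only [zero_add] at h1
  linarith

/-- The residuals in the second half of a long run are square summable with a constant that does
not involve `U`. -/
lemma late_sum_sq_le (H : MultiplierRecursion a r Ψ κ κ₄ θ G U Δ w) {N : ℕ} (hN0 : 0 < N)
    (hN : threshold κ κ₄ θ U Δ w ≤ N) (n : ℕ) :
    ∑ i ∈ Finset.range n, r (N + 3 + i) ^ 2
      ≤ κ * (Δ + 21 * (w * meanBound κ₄ θ G ^ 2)) := by
  -- The stretch is enlarged on the left to a small pair and on the right to a small multiplier.
  -- Monotonicity of `Ψ` allows this, and the gap is then measured with `meanBound` instead of `U`.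
  obtain ⟨i, hi, hpair⟩ := H.exists_pair_le hN0 hN
  obtain ⟨l, hl⟩ := H.exists_le (N + 1 + n)
  have h1 := H.sum_sq_le (N + 1) n
  have e1 : N + 1 + 2 = N + 3 := rfl
  rw [e1] at h1
  refine h1.trans (mul_le_mul_of_nonneg_left ?_ H.κ_nonneg)
  have hm := H.meanBound_nonneg
  have h2 : Ψ (N + 1 + 1) ≤ Ψ (2 + i + 1) := by
    have := H.potential_le (2 + i) (N - i - 1)
    rwa [show 2 + i + 1 + (N - i - 1) = N + 1 + 1 by omega] at this
  have h3 : Ψ (N + 1 + n + 2 + l) ≤ Ψ (N + 1 + 1 + n) := by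
    have := H.potential_le (N + 1 + n) (l + 1)
    rwa [show N + 1 + n + 1 + (l + 1) = N + 1 + n + 2 + l by omega,
      show N + 1 + n + 1 = N + 1 + 1 + n by omega] at this
  have h4 := H.Ψ_gap (2 + i) (N + 1 + n + 1 + l) (2 * meanBound κ₄ θ G) (meanBound κ₄ θ G)
    (by linarith [H.a_nonneg (2 + i + 1)]) (by linarith [H.a_nonneg (2 + i)])
    (by rwa [show N + 1 + n + 1 + l + 1 = N + 1 + n + 2 + l by omega])
  rw [show N + 1 + n + 1 + l + 1 = N + 1 + n + 2 + l by omega] at h4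
  -- Each member of the pair is at most `2 * meanBound`, so `21 = 5·2² + 1`.
  have e2 : w * (5 * (2 * meanBound κ₄ θ G) ^ 2 + meanBound κ₄ θ G ^ 2)
      = 21 * (w * meanBound κ₄ θ G ^ 2) := by ring
  linarith

end MultiplierRecursion

/-! ### The potential of a run and its bounds. -/

namespace Problem

variable {B : ℕ} {E : Fin B → Type*} {Y : Type*}
  [∀ t, NormedAddCommGroup (E t)] [∀ t, InnerProductSpace ℝ (E t)]
  [NormedAddCommGroup Y] [InnerProductSpace ℝ Y]
  [∀ t, FiniteDimensional ℝ (E t)] [FiniteDimensional ℝ Y]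
  {P : Problem E Y} {W : Moduli E} {S : Params}

/-- The potential of a run; it is nonincreasing from index `1` on. -/
def potential (P : Problem E Y) (S : Params) (c : ℝ) (x : ℕ → PiLp 2 E) (p : ℕ → Y) (k : ℕ) : ℝ :=
  P.lagrR S.θ c (x k) (p k) - S.θ * (1 - S.θ) / (2 * S.χ * c) * ‖p k‖ ^ 2
    + (1 - S.θ) * ((2 - S.θ) * (1 - S.θ)) / (2 * S.χ * c * S.θ) * ‖p k - p (k - 1)‖ ^ 2

/-- The exact change of the Lagrangian caused by the multiplier step: a telescoping part, absorbed
by the `‖p‖²` term of `potential`, and a square of the increment that has to be paid for. -/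
lemma multiplier_inner_eq {θ χ c : ℝ} (hχ : χ ≠ 0) (hc : c ≠ 0) {p₁ p₂ F : Y}
    (h : p₂ = (1 - θ) • p₁ + (χ * c) • F) :
    (1 - θ) * inner ℝ (p₂ - p₁) F = (2 - θ) * (1 - θ) / (2 * χ * c) * ‖p₂ - p₁‖ ^ 2
      + θ * (1 - θ) / (2 * χ * c) * (‖p₂‖ ^ 2 - ‖p₁‖ ^ 2) := by
  have h1 : p₂ - p₁ = (χ * c) • F - θ • p₁ := by rw [h]; module
  have h2 : ‖p₂ - p₁‖ ^ 2 = (χ * c) ^ 2 * ‖F‖ ^ 2 - 2 * (χ * c) * θ * inner ℝ F p₁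
      + θ ^ 2 * ‖p₁‖ ^ 2 := by
    rw [h1, norm_sub_sq_real, real_inner_smul_left, inner_smul_right, norm_smul, norm_smul,
      mul_pow, mul_pow, Real.norm_eq_abs, Real.norm_eq_abs, sq_abs, sq_abs]
    ring
  have h3 : ‖p₂‖ ^ 2 = (1 - θ) ^ 2 * ‖p₁‖ ^ 2 + 2 * (1 - θ) * (χ * c) * inner ℝ F p₁
      + (χ * c) ^ 2 * ‖F‖ ^ 2 := by
    rw [h, norm_add_sq_real, real_inner_smul_left, inner_smul_right, norm_smul, norm_smul,
      mul_pow, mul_pow, Real.norm_eq_abs, Real.norm_eq_abs, sq_abs, sq_abs, real_inner_comm]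
    ring
  have h4 : inner ℝ (p₂ - p₁) F = χ * c * ‖F‖ ^ 2 - θ * inner ℝ F p₁ := by
    rw [h1, inner_sub_left, real_inner_smul_left, real_inner_smul_left, real_inner_self_eq_norm_sq,
      real_inner_comm]
  rw [h2, h3, h4]
  field_simp
  ring

/-- The new increment is a convex combination, with weights `1-θ` and `θ`, of the old increment and
a multiple of `F₂ - F₁`; convexity of the squared norm does the rest. The telescoping part explains
the last term of `potential`. -/
lemma multiplier_step_sq_le {θ χ c : ℝ} (hθ : 0 < θ) {p₀ p₁ p₂ F₁ F₂ : Y} (hθ1 : θ ≤ 1)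
    (h₁ : p₁ = (1 - θ) • p₀ + (χ * c) • F₁) (h₂ : p₂ = (1 - θ) • p₁ + (χ * c) • F₂) :
    θ * ‖p₂ - p₁‖ ^ 2 ≤ (1 - θ) * (‖p₁ - p₀‖ ^ 2 - ‖p₂ - p₁‖ ^ 2)
      + (χ * c) ^ 2 / θ * ‖F₂ - F₁‖ ^ 2 := by
  have e1 : p₂ - p₁ = (1 - θ) • (p₁ - p₀) + θ • ((χ * c / θ) • (F₂ - F₁)) := by
    rw [smul_smul, mul_div_cancel₀ _ hθ.ne', smul_sub, smul_sub, sub_eq_iff_eq_add, h₂]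
    nth_rewrite 3 [h₁]
    module
  have e2 := convex_comb_norm_sq (p₁ - p₀) ((χ * c / θ) • (F₂ - F₁)) θ
  rw [← e1] at e2
  have e3 : θ * ‖(χ * c / θ) • (F₂ - F₁)‖ ^ 2 = (χ * c) ^ 2 / θ * ‖F₂ - F₁‖ ^ 2 := by
    rw [norm_smul, mul_pow, Real.norm_eq_abs, sq_abs]
    field_simp
  have e4 : 0 ≤ θ * (1 - θ) * ‖p₁ - p₀ - (χ * c / θ) • (F₂ - F₁)‖ ^ 2 := by
    have : 0 ≤ 1 - θ := by linarith
    positivity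
  linarith

lemma sq_norm_opA_le (P : Problem E Y) (z : PiLp 2 E) :
    ‖P.opA z‖ ^ 2 ≤ B * ∑ t, ‖P.A t (z t)‖ ^ 2 := by
  rw [opA_apply]
  refine (pow_le_pow_left₀ (norm_nonneg _) (norm_sum_le _ _) 2).trans ?_
  have := sq_sum_le_card_mul_sum_sq (s := Finset.univ) (f := fun t => ‖P.A t (z t)‖)
  rwa [Finset.card_univ, Fintype.card_fin] at this

namespace Assumptions

lemma potential_step (hP : P.Assumptions W) (hS : S.Admissible B W.mMax) {c : ℝ} (hc : 0 < c)
    {x₀ : PiLp 2 E} {p₀ : Y} (hx₀ : x₀ ∈ P.dom) {x : ℕ → PiLp 2 E} {p : ℕ → Y}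
    (hrun : P.IsRun S c x₀ p₀ x p) (k : ℕ) :
    P.potential S c x p (k + 2) + P.decrease S c (x (k + 1)) (x (k + 2))
      ≤ P.potential S c x p (k + 1) := by
  have hχ := hS.chi_pos
  have hθ := hS.theta_pos
  have hθ1 := hS.theta_le
  obtain ⟨hd, hsw⟩ := hP.run_isSweep hS.lam_pos hx₀ hrun (k + 1)
  have h1 := hP.lagrR_sweep_le hS hd hsw
  have hp1 := hrun.p_step k
  have hp2 := hrun.p_step (k + 1)
  have h2 := multiplier_inner_eq hχ.ne' hc.ne' hp2
  -- Two consecutive multiplier updates are used, so the potential is compared only from index `1`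
  -- on.
  have h3 := multiplier_step_sq_le hθ hθ1 hp1 hp2
  have h4 : P.feas (x (k + 1 + 1)) - P.feas (x (k + 1)) = P.opA (x (k + 1 + 1) - x (k + 1)) := by
    rw [feas, feas, map_sub]; abel
  rw [h4] at h3
  have h5 := P.sq_norm_opA_le (x (k + 1 + 1) - x (k + 1))
  have h6 : P.lagrR S.θ c (x (k + 1 + 1)) (p (k + 1 + 1))
      = P.lagrR S.θ c (x (k + 1 + 1)) (p (k + 1))
        + (1 - S.θ) * inner ℝ (p (k + 1 + 1) - p (k + 1)) (P.feas (x (k + 1 + 1))) := by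
    rw [lagrR, lagrR, inner_sub_left]; ring
  simp only [PiLp.sub_apply] at h5
  set Q := ∑ t, ‖P.A t (x (k + 1 + 1) t - x (k + 1) t)‖ ^ 2 with hQ
  have hQ0 : 0 ≤ Q := Finset.sum_nonneg fun _ _ => sq_nonneg _
  set b := (2 - S.θ) * (1 - S.θ) with hb
  have hb0 : 0 ≤ b := mul_nonneg (by linarith) (by linarith)
  have h7 : b / (2 * S.χ * c) * ‖p (k + 1 + 1) - p (k + 1)‖ ^ 2
      ≤ (1 - S.θ) * b / (2 * S.χ * c * S.θ)
        * (‖p (k + 1) - p k‖ ^ 2 - ‖p (k + 1 + 1) - p (k + 1)‖ ^ 2) + c / 4 * Q := by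
    have e1 := mul_le_mul_of_nonneg_left h3
      (show 0 ≤ b / (2 * S.χ * c * S.θ) by positivity)
    have e2 : b / (2 * S.χ * c * S.θ) * (S.θ * ‖p (k + 1 + 1) - p (k + 1)‖ ^ 2)
        = b / (2 * S.χ * c) * ‖p (k + 1 + 1) - p (k + 1)‖ ^ 2 := by
      field_simp
    have e3 : b / (2 * S.χ * c * S.θ)
        * ((S.χ * c) ^ 2 / S.θ * ‖P.opA (x (k + 1 + 1) - x (k + 1))‖ ^ 2) ≤ c / 4 * Q := by
      have e4 : b / (2 * S.χ * c * S.θ)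
          * ((S.χ * c) ^ 2 / S.θ * ‖P.opA (x (k + 1 + 1) - x (k + 1))‖ ^ 2)
          ≤ b / (2 * S.χ * c * S.θ) * ((S.χ * c) ^ 2 / S.θ * (B * Q)) := by
        gcongr
      have e5 : b / (2 * S.χ * c * S.θ) * ((S.χ * c) ^ 2 / S.θ * (B * Q))
          = (2 * S.χ * B * b) / S.θ ^ 2 * (c / 4 * Q) := by
        field_simp
        ring
      -- Here the condition linking `χ` and `θ` enters: the multiplier increments use up at most
      -- `c/4` of the available `c/2`, and `decrease` keeps the other `c/4`.
      have e6 : (2 * S.χ * B * b) / S.θ ^ 2 ≤ 1 := by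
        rw [div_le_one (by positivity), hb, ← mul_assoc]
        exact hS.chi_theta
      have e7 : (2 * S.χ * B * b) / S.θ ^ 2 * (c / 4 * Q) ≤ 1 * (c / 4 * Q) :=
        mul_le_mul_of_nonneg_right e6 (by positivity)
      linarith
    have e8 : b / (2 * S.χ * c * S.θ)
        * ((1 - S.θ) * (‖p (k + 1) - p k‖ ^ 2 - ‖p (k + 1 + 1) - p (k + 1)‖ ^ 2))
        = (1 - S.θ) * b / (2 * S.χ * c * S.θ)
          * (‖p (k + 1) - p k‖ ^ 2 - ‖p (k + 1 + 1) - p (k + 1)‖ ^ 2) := by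
      ring
    rw [mul_add, e2, e8] at e1
    linarith
  unfold potential decrease
  simp only [Nat.add_sub_cancel, show k + 2 = k + 1 + 1 from rfl]
  rw [← hQ]
  rw [← hb]
  linarith

/-- Lower bound on the potential. -/
lemma le_potential (hS : S.Admissible B W.mMax) {c : ℝ} (hc : 0 < c)
    (x : ℕ → PiLp 2 E) (p : ℕ → Y) (k : ℕ) {s : ℝ} (hs : ‖p k‖ ≤ s) :
    P.phiR (x k) - 1 / (S.χ ^ 2 * c) * s ^ 2 ≤ P.potential S c x p k := by
  have hχ := hS.chi_pos
  have hχ1 := hS.chi_le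
  have hθ := hS.theta_pos
  have hθ1 : 0 ≤ 1 - S.θ := by linarith [hS.theta_le]
  have hs2 : ‖p k‖ ^ 2 ≤ s ^ 2 := pow_le_pow_left₀ (norm_nonneg _) hs 2
  have h1 : -(1 / (2 * c) * ‖p k‖ ^ 2)
      ≤ (1 - S.θ) * inner ℝ (p k) (P.feas (x k)) + c / 2 * ‖P.feas (x k)‖ ^ 2 := by
    have e1 := (abs_le.1 (abs_real_inner_le_norm (p k) (P.feas (x k)))).1
    have e2 := mul_le_mul_of_nonneg_left e1 hθ1
    have e3 : (1 - S.θ) * (‖p k‖ * ‖P.feas (x k)‖) ≤ ‖p k‖ * ‖P.feas (x k)‖ := by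
      have : 0 ≤ ‖p k‖ * ‖P.feas (x k)‖ := by positivity
      nlinarith
    -- Completing the square: the penalty absorbs the inner product at the price `‖p‖²/(2c)`. This
    -- and the negative term of the potential each cost at most `‖p‖²/(2χ²c)`.
    have e4 : 0 ≤ 1 / (2 * c) * (‖p k‖ - c * ‖P.feas (x k)‖) ^ 2 := by positivity
    have e5 : 1 / (2 * c) * (‖p k‖ - c * ‖P.feas (x k)‖) ^ 2
        = 1 / (2 * c) * ‖p k‖ ^ 2 - ‖p k‖ * ‖P.feas (x k)‖ + c / 2 * ‖P.feas (x k)‖ ^ 2 := by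
      field_simp
      ring
    linarith
  have h2 : S.θ * (1 - S.θ) / (2 * S.χ * c) * ‖p k‖ ^ 2
      ≤ 1 / (2 * (S.χ ^ 2 * c)) * ‖p k‖ ^ 2 := by
    apply mul_le_mul_of_nonneg_right _ (sq_nonneg _)
    rw [div_le_div_iff₀ (by positivity) (by positivity)]
    have e1 : S.θ * (1 - S.θ) ≤ 1 := by nlinarith
    have e2 : S.χ ^ 2 ≤ S.χ := by nlinarith
    have e3 : S.θ * (1 - S.θ) * S.χ ^ 2 ≤ 1 * S.χ := mul_le_mul e1 e2 (by positivity) (by norm_num)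
    nlinarith
  have h3 : 1 / (2 * c) * ‖p k‖ ^ 2 ≤ 1 / (2 * (S.χ ^ 2 * c)) * ‖p k‖ ^ 2 := by
    apply mul_le_mul_of_nonneg_right _ (sq_nonneg _)
    have e2 : S.χ ^ 2 ≤ 1 := by nlinarith
    apply one_div_le_one_div_of_le (by positivity)
    nlinarith
  have h4 : 1 / (2 * (S.χ ^ 2 * c)) * ‖p k‖ ^ 2 + 1 / (2 * (S.χ ^ 2 * c)) * ‖p k‖ ^ 2
      ≤ 1 / (S.χ ^ 2 * c) * s ^ 2 := by
    have e1 : 1 / (2 * (S.χ ^ 2 * c)) * ‖p k‖ ^ 2 + 1 / (2 * (S.χ ^ 2 * c)) * ‖p k‖ ^ 2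
        = 1 / (S.χ ^ 2 * c) * ‖p k‖ ^ 2 := by
      field_simp
      ring
    rw [e1]
    exact mul_le_mul_of_nonneg_left hs2 (by positivity)
  have h5 : 0 ≤ (1 - S.θ) * ((2 - S.θ) * (1 - S.θ)) / (2 * S.χ * c * S.θ)
      * ‖p k - p (k - 1)‖ ^ 2 := by
    have : 0 ≤ 2 - S.θ := by linarith
    positivity
  unfold potential lagrR
  linarith

/-- The multiplier update solved for `Ax - d`. Bounded multipliers thus force infeasibility of order
`1/c`. -/
lemma norm_feas_run_le (hS : S.Admissible B W.mMax) {c : ℝ} (hc : 0 < c)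
    {x₀ : PiLp 2 E} {p₀ : Y} {x : ℕ → PiLp 2 E} {p : ℕ → Y}
    (hrun : P.IsRun S c x₀ p₀ x p) (k : ℕ) :
    ‖P.feas (x (k + 1))‖ ≤ 1 / (S.χ * c) * (‖p (k + 1)‖ + ‖p k‖) := by
  have hχ := hS.chi_pos
  have hθ := hS.theta_pos
  have hθ1 : 0 ≤ 1 - S.θ := by linarith [hS.theta_le]
  have h1 : (S.χ * c) • P.feas (x (k + 1)) = p (k + 1) - (1 - S.θ) • p k := by
    rw [hrun.p_step k]; abel
  have h2 : S.χ * c * ‖P.feas (x (k + 1))‖ ≤ ‖p (k + 1)‖ + ‖p k‖ := by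
    have e1 : S.χ * c * ‖P.feas (x (k + 1))‖ = ‖(S.χ * c) • P.feas (x (k + 1))‖ := by
      rw [norm_smul, Real.norm_of_nonneg (by positivity)]
    rw [e1, h1]
    refine (norm_sub_le _ _).trans ?_
    rw [norm_smul, Real.norm_of_nonneg hθ1]
    nlinarith [norm_nonneg (p k)]
  rw [one_div_mul_eq_div, le_div_iff₀ (by positivity)]
  linarith

/-- Upper bound on the potential. -/
lemma potential_le_of_norm_le (hP : P.Assumptions W) (hS : S.Admissible B W.mMax) {c : ℝ}
    (hc : 0 < c) {x₀ : PiLp 2 E} {p₀ : Y} {x : ℕ → PiLp 2 E} {p : ℕ → Y}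
    (hrun : P.IsRun S c x₀ p₀ x p) (k : ℕ) {s : ℝ} (hs : ‖p k‖ ≤ s) (hs' : ‖p (k + 1)‖ ≤ s) :
    P.potential S c x p (k + 1) ≤ P.phiR (x (k + 1)) + 1 / (S.χ ^ 2 * c) * (5 * s ^ 2) := by
  have hχ := hS.chi_pos
  have hχ1 := hS.chi_le
  have hθ := hS.theta_pos
  have hθ1 : 0 ≤ 1 - S.θ := by linarith [hS.theta_le]
  have hs0 : 0 ≤ s := (norm_nonneg _).trans hs
  have hB1 : (1 : ℝ) ≤ B := by exact_mod_cast hP.blocks_pos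
  set F := P.feas (x (k + 1)) with hFdef
  have hF : ‖F‖ ≤ 2 * s / (S.χ * c) := by
    refine (norm_feas_run_le hS hc hrun k).trans ?_
    rw [one_div_mul_eq_div]
    gcongr
    linarith
  -- The inner product, the penalty and the increment term contribute `2`, `2` and `1` times
  -- `s²/(χ²c)`, which makes the `5` in the statement.
  have h1 : (1 - S.θ) * inner ℝ (p (k + 1)) F ≤ 1 / (S.χ ^ 2 * c) * (2 * s ^ 2) := by
    have e1 := real_inner_le_norm (p (k + 1)) F
    have e2 : ‖p (k + 1)‖ * ‖F‖ ≤ s * (2 * s / (S.χ * c)) :=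
      mul_le_mul hs' hF (norm_nonneg _) hs0
    have e3 : (1 - S.θ) * inner ℝ (p (k + 1)) F ≤ s * (2 * s / (S.χ * c)) := by
      have e4 := mul_le_mul_of_nonneg_left (e1.trans e2) hθ1
      have e5 : 0 ≤ s * (2 * s / (S.χ * c)) := by positivity
      nlinarith
    refine e3.trans ?_
    have e6 : s * (2 * s / (S.χ * c)) = 1 / (S.χ ^ 2 * c) * (2 * s ^ 2) * S.χ := by
      field_simp
    rw [e6]
    exact mul_le_of_le_one_right (by positivity) hχ1
  have h2 : c / 2 * ‖F‖ ^ 2 ≤ 1 / (S.χ ^ 2 * c) * (2 * s ^ 2) := by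
    have e1 := pow_le_pow_left₀ (norm_nonneg _) hF 2
    have e2 : 1 / (S.χ ^ 2 * c) * (2 * s ^ 2) = c / 2 * (2 * s / (S.χ * c)) ^ 2 := by
      field_simp
    rw [e2]
    exact mul_le_mul_of_nonneg_left e1 (by positivity)
  have h3 : 0 ≤ S.θ * (1 - S.θ) / (2 * S.χ * c) * ‖p (k + 1)‖ ^ 2 := by positivity
  have h4 : (1 - S.θ) * ((2 - S.θ) * (1 - S.θ)) / (2 * S.χ * c * S.θ) * ‖p (k + 1) - p k‖ ^ 2
      ≤ 1 / (S.χ ^ 2 * c) * s ^ 2 := by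
    have e1 : ‖p (k + 1) - p k‖ ≤ 2 * s := (norm_sub_le _ _).trans (by linarith)
    have e2 : ‖p (k + 1) - p k‖ ^ 2 ≤ 4 * s ^ 2 := by
      refine (pow_le_pow_left₀ (norm_nonneg _) e1 2).trans (by nlinarith)
    have e3 : (1 - S.θ) * ((2 - S.θ) * (1 - S.θ)) / (2 * S.χ * c * S.θ)
        ≤ 1 / (S.χ ^ 2 * c) * (1 / 4) := by
      have hbχ : 2 * S.χ * ((2 - S.θ) * (1 - S.θ)) ≤ S.θ ^ 2 := by
        refine le_trans ?_ hS.chi_theta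
        have : 0 ≤ 2 * S.χ * ((2 - S.θ) * (1 - S.θ)) := by
          have : 0 ≤ 2 - S.θ := by linarith
          positivity
        nlinarith
      rw [one_div_mul_one_div, div_le_div_iff₀ (by positivity) (by positivity)]
      have e4 : (1 - S.θ) * (2 * S.χ * ((2 - S.θ) * (1 - S.θ))) ≤ 1 * S.θ ^ 2 :=
        mul_le_mul (by linarith) hbχ (by
          have : 0 ≤ 2 - S.θ := by linarith
          positivity) (by norm_num)
      have e5 : (1 - S.θ) * S.θ ≤ 1 / 4 := by nlinarith [sq_nonneg (S.θ - 1 / 2)]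
      have e6 : (1 - S.θ) * (2 * S.χ * ((2 - S.θ) * (1 - S.θ))) ≤ S.θ := by
        have e7 := mul_le_mul_of_nonneg_left hbχ hθ1
        nlinarith
      have e8 : 0 < 2 * S.χ * c := by positivity
      have e9 := mul_le_mul_of_nonneg_left e6 e8.le
      nlinarith
    have e10 : 0 ≤ 1 / (S.χ ^ 2 * c) * (1 / 4) := by positivity
    calc _ ≤ 1 / (S.χ ^ 2 * c) * (1 / 4) * (4 * s ^ 2) :=
          mul_le_mul e3 e2 (sq_nonneg _) e10
      _ = _ := by ring
  unfold potential lagrR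
  rw [Nat.add_sub_cancel, ← hFdef]
  linarith

/-- The singular value bound holds only on the range of `A`. That range is preserved because `d = A
z_†`. -/
lemma run_mem_range (hP : P.Assumptions W) {c : ℝ} {x₀ : PiLp 2 E} {p₀ : Y}
    (hp₀ : p₀ ∈ Set.range P.opA) {x : ℕ → PiLp 2 E} {p : ℕ → Y}
    (hrun : P.IsRun S c x₀ p₀ x p) (k : ℕ) : p k ∈ Set.range P.opA := by
  induction k with
  | zero => rw [hrun.p_zero]; exact hp₀
  | succ k ih =>
    obtain ⟨w, hw⟩ := ih
    refine ⟨(1 - S.θ) • w + (S.χ * c) • (x (k + 1) - W.zdag), ?_⟩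
    rw [map_add, map_smul, map_smul, hw, ← hP.feas_eq, hrun.p_step k]

/-- Since `θκ1 = χ‖A‖D_†`, the ball of radius `c(R + κ1)` is invariant under the update. This is the
crude bound `U` of the abstract recursion. -/
lemma norm_run_le (hP : P.Assumptions W) (hS : S.Admissible B W.mMax) {c R : ℝ} (hc : 0 < c)
    (hR : 0 ≤ R) {x₀ : PiLp 2 E} {p₀ : Y} (hx₀ : x₀ ∈ P.dom) (hp₀ : ‖p₀‖ ≤ c * R)
    {x : ℕ → PiLp 2 E} {p : ℕ → Y} (hrun : P.IsRun S c x₀ p₀ x p) (k : ℕ) :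
    ‖p k‖ ≤ c * (R + P.κ1 W S) := by
  have hχ := hS.chi_pos
  have hθ := hS.theta_pos
  have hθ1 : 0 ≤ 1 - S.θ := by linarith [hS.theta_le]
  have hD := hP.DDag_pos
  have hκ1 : S.θ * P.κ1 W S = S.χ * (‖P.opA‖ * P.DDag W) := by
    rw [κ1]; field_simp
  have hκ1' : 0 ≤ P.κ1 W S := by unfold κ1; positivity
  induction k with
  | zero =>
    rw [hrun.p_zero]
    nlinarith [mul_nonneg hc.le hκ1']
  | succ k ih =>
    rw [hrun.p_step k]
    refine (norm_add_le _ _).trans ?_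
    rw [norm_smul, norm_smul, Real.norm_of_nonneg hθ1, Real.norm_of_nonneg (by positivity)]
    have h1 := mul_le_mul_of_nonneg_left ih hθ1
    have h2 := mul_le_mul_of_nonneg_left
      (hP.norm_feas_le (hP.run_isSweep hS.lam_pos hx₀ hrun (k + 1)).1)
      (show 0 ≤ S.χ * c by positivity)
    have h3 : S.χ * c * (‖P.opA‖ * P.DDag W) = c * (S.θ * P.κ1 W S) := by rw [hκ1]; ring
    have h4 : 0 ≤ S.θ * (c * R) := by positivity
    nlinarith

theorem multiplierRecursion (hP : P.Assumptions W) (hS : S.Admissible B W.mMax) {c R : ℝ}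
    (hc : 0 < c) (hR : 0 ≤ R) {x₀ : PiLp 2 E} {p₀ : Y} (hx₀ : x₀ ∈ P.dom)
    (hp₀ : p₀ ∈ Set.range P.opA) (hp₀' : ‖p₀‖ ≤ c * R)
    {x : ℕ → PiLp 2 E} {p : ℕ → Y} (hrun : P.IsRun S c x₀ p₀ x p) :
    MultiplierRecursion (fun k => ‖p k‖) (fun k => ‖P.vIter S c x k‖) (P.potential S c x p)
      (P.κ0 W S ^ 2 + P.κ5 * c) (P.κ4 W S) S.θ (W.Kh + P.Gf) (c * (R + P.κ1 W S)) P.deltaPhi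
      (1 / (S.χ ^ 2 * c)) := by
  have hχ := hS.chi_pos
  have hκ5 := hP.κ5_nonneg
  have hmem := fun k => (hP.run_isSweep hS.lam_pos hx₀ hrun k).1
  have hdec : ∀ k, 0 ≤ P.decrease S c (x (k + 1)) (x (k + 2)) := by
    intro k
    have := hS.lam_pos
    unfold decrease
    positivity
  refine
    { κ_nonneg := by positivity
      κ₄_pos := hP.κ4_pos hS
      θ_pos := hS.theta_pos
      θ_le := hS.theta_le
      G_nonneg := add_nonneg hP.Kh_nonneg hP.Gf_nonneg
      w_nonneg := by positivity
      Δ_nonneg := hP.deltaPhi_nonneg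
      a_nonneg := fun k => norm_nonneg _
      a_le := hP.norm_run_le hS hc hR hx₀ hp₀' hrun
      a_rec := fun k => ?_
      r_sq := fun k => ?_
      Ψ_anti := fun k => ?_
      Ψ_gap := fun j k s s' h1 h2 h3 => ?_ }
  · have h := hP.norm_multiplier_le hS hc (hP.run_mem_range hp₀ hrun k) (hmem k)
      (hP.run_isSweep hS.lam_pos hx₀ hrun k).2
    rw [← hrun.p_step k, ← vIter_succ] at h
    exact h
  · refine (hP.sq_norm_sweepRes_le hS hc.le (hmem (k + 1)) (hmem (k + 2))).trans ?_
    have := hP.potential_step hS hc hx₀ hrun k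
    exact mul_le_mul_of_nonneg_left (by linarith) (by positivity)
  · have := hP.potential_step hS hc hx₀ hrun k
    linarith [hdec k]
  · have e1 := hP.potential_le_of_norm_le hS hc hrun j h1 h2
    have e2 := le_potential (P := P) hS hc x p (k + 1) h3
    have e3 := hP.phiR_sub_le (hmem (j + 1)) (hmem (k + 1))
    linarith

end Assumptions

end Problem

/-! ### Termination, stationarity of the output, and success below `c³` iterations. -/

namespace Problem

variable {B : ℕ} {E : Fin B → Type*} {Y : Type*}
  [∀ t, NormedAddCommGroup (E t)] [∀ t, InnerProductSpace ℝ (E t)]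
  [NormedAddCommGroup Y] [InnerProductSpace ℝ Y]
  [∀ t, FiniteDimensional ℝ (E t)] [FiniteDimensional ℝ Y]
  {P : Problem E Y} {W : Moduli E} {S : Params}

lemma sum_Icc_eq_sum_range (g : ℕ → ℝ) (m : ℕ) :
    ∑ i ∈ Finset.Icc m (2 * m), g i = ∑ i ∈ Finset.range (m + 1), g (m + i) := by
  rw [← Finset.Ico_add_one_right_eq_Icc, Finset.sum_Ico_eq_sum_range]
  congr 2
  omega

namespace Assumptions

lemma meanBound_eq (hP : P.Assumptions W) (hS : S.Admissible B W.mMax) :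
    MultiplierRecursion.meanBound (P.κ4 W S) S.θ (W.Kh + P.Gf) = P.κ2 W S := by
  have := hP.dDag_pos
  have := hP.DDag_pos
  have := hP.sigmaPlus_pos
  have := hS.chi_pos
  have := hS.theta_pos
  have h : 2 * (W.Kh + P.Gf) / P.κ4 W S
      = 2 * S.χ * P.DDag W * (W.Kh + P.Gf) / (S.θ * P.dDag W * P.sigmaPlus) := by
    rw [κ4]
    field_simp
  rw [MultiplierRecursion.meanBound, h, κ2]

/-- The bound regrouped into the separate requirements on the run: room for index shifts, the window
threshold, infeasibility, and residual. -/
lemma iterBound_eq (hP : P.Assumptions W) (hS : S.Admissible B W.mMax) {c : ℝ} (hc : 0 < c)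
    (ρ η cl R : ℝ) :
    P.iterBound W S c ρ η cl R = 48 * (3
      + MultiplierRecursion.threshold (P.κ0 W S ^ 2 + P.κ5 * c) (P.κ4 W S) S.θ
          (c * (R + P.κ1 W S)) P.deltaPhi (1 / (S.χ ^ 2 * c))
      + 108 * P.κ2 W S ^ 2 / S.χ ^ 2 / η ^ 2 * c
      + 3 * (P.κ0 W S ^ 2 + P.κ5 * c) * P.κt0 W S cl ^ 2 / ρ ^ 2) := by
  have hκ4 := hP.κ4_pos hS
  have hχ := hS.chi_pos
  have h : 1 / (S.χ ^ 2 * c) * (c * (R + P.κ1 W S)) ^ 2 = c * (R + P.κ1 W S) ^ 2 / S.χ ^ 2 := by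
    field_simp
  rw [iterBound, κ6, κt1, κt2, κ3, ξ0, ξ1, MultiplierRecursion.threshold, h]
  field_simp
  ring

lemma κ1_nonneg (hP : P.Assumptions W) (hS : S.Admissible B W.mMax) : 0 ≤ P.κ1 W S := by
  have := hP.DDag_pos
  have := hS.chi_pos
  have := hS.theta_pos
  unfold κ1
  positivity

lemma κ2_nonneg (hP : P.Assumptions W) (hS : S.Admissible B W.mMax) : 0 ≤ P.κ2 W S := by
  have := hP.dDag_pos
  have := hP.DDag_pos
  have := hP.sigmaPlus_pos
  have := hS.chi_pos
  have := hS.theta_pos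
  have := hP.Kh_nonneg
  have := hP.Gf_nonneg
  unfold κ2
  positivity

/-- The second test holds at every even index that is large enough. -/
lemma failTest_of_large (hP : P.Assumptions W) (hS : S.Admissible B W.mMax) {c cl R ρ η : ℝ}
    (hcl : 0 < cl) (hc : cl ≤ c) (hR : 0 ≤ R) (hρ : 0 < ρ) (hη : 0 < η)
    {x₀ : PiLp 2 E} {p₀ : Y} (hx₀ : x₀ ∈ P.dom)
    (hp₀ : p₀ ∈ Set.range P.opA) (hp₀' : ‖p₀‖ ≤ c * R)
    {x : ℕ → PiLp 2 E} {p : ℕ → Y} (hrun : P.IsRun S c x₀ p₀ x p) {m : ℕ}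
    (hm : P.iterBound W S c ρ η cl R ≤ 2 * (m + 1)) :
    P.FailTest S ρ η c x (2 * m) := by
  have hc0 : 0 < c := hcl.trans_le hc
  have hχ := hS.chi_pos
  have hθ := hS.theta_pos
  have hθ1 : 0 ≤ 1 - S.θ := by linarith [hS.theta_le]
  have hκ4 := hP.κ4_pos hS
  have hκ5 := hP.κ5_nonneg
  have hκ2 := hP.κ2_nonneg hS
  have hκ1 := hP.κ1_nonneg hS
  have hΔ := hP.deltaPhi_nonneg
  have H := hP.multiplierRecursion hS hc0 hR hx₀ hp₀ hp₀' hrun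
  rw [hP.iterBound_eq hS hc0] at hm
  have hmean := hP.meanBound_eq hS
  set κ := P.κ0 W S ^ 2 + P.κ5 * c with hκ
  set thr := MultiplierRecursion.threshold κ (P.κ4 W S) S.θ (c * (R + P.κ1 W S)) P.deltaPhi
    (1 / (S.χ ^ 2 * c)) with hthr
  have hκ0 : 0 ≤ κ := H.κ_nonneg
  have hthr0 : 0 ≤ thr := by
    rw [hthr, MultiplierRecursion.threshold]
    positivity
  have hT1 : 0 ≤ 108 * P.κ2 W S ^ 2 / S.χ ^ 2 / η ^ 2 * c := by positivity
  have hT2 : 0 ≤ 3 * κ * P.κt0 W S cl ^ 2 / ρ ^ 2 := by positivity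
  -- The summand `48·3` of the bound forces this, so the shifted indices `m - 3` and `m - 2` are
  -- genuine subtractions.
  have hm4R : (71 : ℝ) ≤ m := by linarith
  have hm4 : 71 ≤ m := by exact_mod_cast hm4R
  have hn0 : (0 : ℝ) < (m : ℝ) + 1 := by linarith
  refine ⟨even_two_mul m, by omega, ?_⟩
  rw [Nat.mul_div_cancel_left m two_pos, sum_Icc_eq_sum_range, sum_Icc_eq_sum_range]
  have hcast : ((2 * m : ℕ) : ℝ) = 2 * m := by push_cast; ring
  have hfrac : 2 / (((2 * m : ℕ) : ℝ) + 2) = 1 / ((m : ℝ) + 1) := by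
    rw [hcast]
    field_simp
  rw [hfrac, hcast]
  have hV : ∑ i ∈ Finset.range (m + 1), ‖P.vIter S c x (m + i)‖ ≤ ((m + 1 : ℕ) : ℝ) * (ρ / 2) := by
    apply MultiplierRecursion.sum_le_mul_of_sum_sq_le (by positivity)
    have hcast3 : ((m - 3 : ℕ) : ℝ) = (m : ℝ) - 3 := by
      rw [Nat.cast_sub (by omega)]; norm_num
    -- With window length `m - 3`, the late residuals start exactly at index `m = k/2`, where the
    -- averages of the test start.
    have h1 := H.late_sum_sq_le (N := m - 3) (by omega) (by rw [hcast3]; linarith) (m + 1)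
    rw [show m - 3 + 3 = m by omega, hmean] at h1
    refine h1.trans ?_
    -- The factor `4` comes from the target `ρ/2`; the constants leave slack, since `4·21 ≤ 3·4·25`.
    -- Replacing `c` by `cl` makes the bound independent of the penalty.
    have h2 : 4 * (P.deltaPhi + 21 * (1 / (S.χ ^ 2 * c) * P.κ2 W S ^ 2)) ≤ 3 * P.κt0 W S cl ^ 2 := by
      have e1 : P.κt0 W S cl ^ 2 = 4 * (Real.sqrt P.deltaPhi ^ 2
          + 2 * Real.sqrt P.deltaPhi * (5 * P.κ2 W S / (S.χ * Real.sqrt cl))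
          + 25 * (P.κ2 W S ^ 2 / (S.χ ^ 2 * Real.sqrt cl ^ 2))) := by
        rw [κt0]
        ring
      rw [Real.sq_sqrt hΔ, Real.sq_sqrt hcl.le] at e1
      have e2 : 0 ≤ 2 * Real.sqrt P.deltaPhi * (5 * P.κ2 W S / (S.χ * Real.sqrt cl)) := by
        positivity
      have e3 : 1 / (S.χ ^ 2 * c) * P.κ2 W S ^ 2 ≤ P.κ2 W S ^ 2 / (S.χ ^ 2 * cl) := by
        rw [one_div_mul_eq_div]
        gcongr
      have e4 : 0 ≤ P.κ2 W S ^ 2 / (S.χ ^ 2 * cl) := by positivity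
      rw [e1]
      linarith
    have h3 := mul_le_mul_of_nonneg_left h2 hκ0
    have h4 : 3 * κ * P.κt0 W S cl ^ 2 / ρ ^ 2 ≤ (m : ℝ) + 1 := by linarith
    rw [div_le_iff₀ (by positivity)] at h4
    push_cast
    nlinarith
  have hF : ∑ i ∈ Finset.range (m + 1), ‖P.feas (x (m + i))‖
      ≤ 1 / (S.χ * c) * (((m + 1 : ℕ) : ℝ) * (2 * P.κ2 W S)) := by
    have hN : thr ≤ ((m + 1 : ℕ) : ℝ) := by push_cast; linarith
    -- Infeasibility at `m + i` involves the multipliers at `m + i` and `m + i - 1`, so windows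
    -- starting at `m` and at `m - 1` are needed.
    have h1 := H.window_sum_le (m - 2) (m + 1) hN
    have h2 := H.window_sum_le (m - 3) (m + 1) hN
    rw [hmean] at h1 h2
    have h3 : ∀ i ∈ Finset.range (m + 1), ‖P.feas (x (m + i))‖
        ≤ 1 / (S.χ * c) * (‖p (m - 2 + 2 + i)‖ + ‖p (m - 3 + 2 + i)‖) := by
      intro i _
      have := norm_feas_run_le hS hc0 hrun (m - 3 + 2 + i)
      rw [show m - 3 + 2 + i + 1 = m + i by omega] at this
      rw [show m - 2 + 2 + i = m + i by omega]
      exact this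
    refine (Finset.sum_le_sum h3).trans ?_
    rw [← Finset.mul_sum, Finset.sum_add_distrib]
    apply mul_le_mul_of_nonneg_left _ (by positivity)
    linarith
  have hsqrt : 1 / η * Real.sqrt (c ^ 3 / (2 * m)) * (1 / (S.χ * c) * (2 * P.κ2 W S)) ≤ 1 / 2 := by
    have hm0 : (0 : ℝ) < m := by linarith
    apply le_of_sq_le_sq _ (by norm_num)
    have e1 : (1 / η * Real.sqrt (c ^ 3 / (2 * m)) * (1 / (S.χ * c) * (2 * P.κ2 W S))) ^ 2
        = 1 / η ^ 2 * (Real.sqrt (c ^ 3 / (2 * m)) ^ 2)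
          * (1 / (S.χ * c) ^ 2 * (4 * P.κ2 W S ^ 2)) := by ring
    rw [e1, Real.sq_sqrt (by positivity)]
    have e2 : 1 / η ^ 2 * (c ^ 3 / (2 * m)) * (1 / (S.χ * c) ^ 2 * (4 * P.κ2 W S ^ 2))
        = (108 * P.κ2 W S ^ 2 / S.χ ^ 2 / η ^ 2 * c) / (54 * m) := by
      field_simp
      ring
    rw [e2, div_le_iff₀ (by positivity)]
    linarith
  have hA : 1 / ρ * (1 / ((m : ℝ) + 1) * ∑ i ∈ Finset.range (m + 1), ‖P.vIter S c x (m + i)‖)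
      ≤ 1 / 2 := by
    have e1 := mul_le_mul_of_nonneg_left hV (show 0 ≤ 1 / ρ * (1 / ((m : ℝ) + 1)) by positivity)
    have e2 : 1 / ρ * (1 / ((m : ℝ) + 1)) * (((m + 1 : ℕ) : ℝ) * (ρ / 2)) = 1 / 2 := by
      push_cast
      field_simp
    rw [e2, mul_assoc] at e1
    exact e1
  have hB : 1 / η * Real.sqrt (c ^ 3 / (2 * m))
      * (1 / ((m : ℝ) + 1) * ∑ i ∈ Finset.range (m + 1), ‖P.feas (x (m + i))‖) ≤ 1 / 2 := by
    refine le_trans ?_ hsqrt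
    apply mul_le_mul_of_nonneg_left _ (by positivity)
    have e1 := mul_le_mul_of_nonneg_left hF (show 0 ≤ 1 / ((m : ℝ) + 1) by positivity)
    refine e1.trans (le_of_eq ?_)
    push_cast
    field_simp
  linarith

lemma threshold_nonneg (hP : P.Assumptions W) (hS : S.Admissible B W.mMax) {c R : ℝ}
    (hc : 0 < c) (hR : 0 ≤ R) :
    0 ≤ MultiplierRecursion.threshold (P.κ0 W S ^ 2 + P.κ5 * c) (P.κ4 W S) S.θ
      (c * (R + P.κ1 W S)) P.deltaPhi (1 / (S.χ ^ 2 * c)) := by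
  have := hP.κ4_pos hS
  have := hP.κ5_nonneg
  have := hP.κ1_nonneg hS
  have := hP.deltaPhi_nonneg
  have := hS.chi_pos
  have : 0 ≤ 1 - S.θ := by linarith [hS.theta_le]
  rw [MultiplierRecursion.threshold]
  positivity

lemma le_iterBound (hP : P.Assumptions W) (hS : S.Admissible B W.mMax) {c R ρ η : ℝ} (cl : ℝ)
    (hc : 0 < c) (hR : 0 ≤ R) (hρ : 0 < ρ) (hη : 0 < η) :
    144 ≤ P.iterBound W S c ρ η cl R := by
  have h1 := hP.threshold_nonneg hS hc hR
  have h2 := hP.κ5_nonneg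
  have h3 := hS.chi_pos
  rw [hP.iterBound_eq hS hc]
  have hT1 : 0 ≤ 108 * P.κ2 W S ^ 2 / S.χ ^ 2 / η ^ 2 * c := by positivity
  have hT2 : 0 ≤ 3 * (P.κ0 W S ^ 2 + P.κ5 * c) * P.κt0 W S cl ^ 2 / ρ ^ 2 := by positivity
  linarith

/-- The method stops within the iteration bound. -/
theorem exists_stops (hP : P.Assumptions W) (hS : S.Admissible B W.mMax) {c cl R ρ η : ℝ}
    (hcl : 0 < cl) (hc : cl ≤ c) (hR : 0 ≤ R) (hρ : 0 < ρ) (hη : 0 < η)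
    {x₀ : PiLp 2 E} {p₀ : Y} (hx₀ : x₀ ∈ P.dom)
    (hp₀ : p₀ ∈ Set.range P.opA) (hp₀' : ‖p₀‖ ≤ c * R)
    {x : ℕ → PiLp 2 E} {p : ℕ → Y} (hrun : P.IsRun S c x₀ p₀ x p) :
    ∃ k : ℕ, (P.StopsSuccess S ρ η c x k ∨ P.StopsFail S ρ η c x k) ∧
      (k : ℝ) ≤ P.iterBound W S c ρ η cl R := by
  classical
  set T := P.iterBound W S c ρ η cl R with hT
  have hT144 : 144 ≤ T := hP.le_iterBound hS cl (hcl.trans_le hc) hR hρ hη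
  -- This gives `2m ≤ T < 2(m+1)`: the even index `2m` stays within the bound and is large enough
  -- for the second test.
  set m := ⌊T / 2⌋₊ with hm
  have hm1 : (m : ℝ) ≤ T / 2 := Nat.floor_le (by linarith)
  have hm2 : T / 2 < m + 1 := Nat.lt_floor_add_one _
  have hfail : P.FailTest S ρ η c x (2 * m) :=
    hP.failTest_of_large hS hcl hc hR hρ hη hx₀ hp₀ hp₀' hrun (by rw [← hT]; linarith)
  have hex : ∃ k, 1 ≤ k ∧ (P.SuccessTest S ρ η c x k ∨ P.FailTest S ρ η c x k) :=
    ⟨2 * m, by have := hfail.2.1; omega, Or.inr hfail⟩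
  have hspec := Nat.find_spec hex
  have hreach : P.Reaches S ρ η c x (Nat.find hex) := by
    refine ⟨hspec.1, fun i hi1 hi => ?_⟩
    have := Nat.find_min hex hi
    push Not at this
    exact this hi1
  refine ⟨Nat.find hex, ?_, ?_⟩
  · by_cases hs : P.SuccessTest S ρ η c x (Nat.find hex)
    · exact Or.inl ⟨hreach, hs⟩
    · exact Or.inr ⟨hreach, hs, hspec.2.resolve_left hs⟩
  · have h1 : Nat.find hex ≤ 2 * m :=
      Nat.find_min' hex ⟨by have := hfail.2.1; omega, Or.inr hfail⟩
    have h2 : ((Nat.find hex : ℕ) : ℝ) ≤ 2 * m := by exact_mod_cast h1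
    linarith

theorem isStationaryPair_of_stopsSuccess (hP : P.Assumptions W) (hS : S.Admissible B W.mMax)
    {c ρ η : ℝ} {x₀ : PiLp 2 E} {p₀ : Y} (hx₀ : x₀ ∈ P.dom)
    {x : ℕ → PiLp 2 E} {p : ℕ → Y} (hrun : P.IsRun S c x₀ p₀ x p) {k : ℕ}
    (hk : P.StopsSuccess S ρ η c x k) :
    P.IsStationaryPair ρ η (x k) (P.qIter S c x p k) := by
  obtain ⟨⟨hk1, -⟩, hv, hf⟩ := hk
  obtain ⟨n, rfl⟩ : ∃ n, k = n + 1 := ⟨k - 1, by omega⟩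
  obtain ⟨hd, hsw⟩ := hP.run_isSweep hS.lam_pos hx₀ hrun n
  exact hP.isStationaryPair_of_sweep hS hd hsw hv hf

end Assumptions

/-- When the penalty dominates the iteration count, the second test cannot precede the first. -/
lemma exists_successTest_of_failTest {c ρ η : ℝ} (hρ : 0 < ρ) (hη : 0 < η)
    {x : ℕ → PiLp 2 E} {k : ℕ} (hk : (k : ℝ) ≤ c ^ 3) (h : P.FailTest S ρ η c x k) :
    ∃ i, 1 ≤ i ∧ i ≤ k ∧ P.SuccessTest S ρ η c x i := by
  obtain ⟨heven, hk3, hle⟩ := h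
  obtain ⟨m, rfl⟩ : ∃ m, k = 2 * m := by
    obtain ⟨m, hm⟩ := heven
    exact ⟨m, by omega⟩
  by_contra hcon
  push Not at hcon
  rw [Nat.mul_div_cancel_left m two_pos, sum_Icc_eq_sum_range, sum_Icc_eq_sum_range] at hle
  have hkpos : (0 : ℝ) < ((2 * m : ℕ) : ℝ) := by exact_mod_cast (by omega : 0 < 2 * m)
  -- The assumption `k ≤ c³` enters only here.
  have hs1 : 1 ≤ Real.sqrt (c ^ 3 / ((2 * m : ℕ) : ℝ)) := by
    rw [Real.one_le_sqrt, one_le_div hkpos]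
    exact hk
  have hfrac : 2 / (((2 * m : ℕ) : ℝ) + 2) = 1 / ((m : ℝ) + 1) := by
    push_cast
    field_simp
  rw [hfrac] at hle
  -- If no iterate of the window passes the first test, each weighted sum exceeds `1`, and so does
  -- their average, contradicting the second test.
  have hgt : ∀ i ∈ Finset.range (m + 1),
      1 < 1 / ρ * ‖P.vIter S c x (m + i)‖ + 1 / η * ‖P.feas (x (m + i))‖ := by
    intro i hi
    have hi' := Finset.mem_range.1 hi
    have h1 := hcon (m + i) (by omega) (by omega)
    rw [SuccessTest, not_and_or] at h1
    have h2 : 0 ≤ 1 / ρ * ‖P.vIter S c x (m + i)‖ := by positivity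
    have h3 : 0 ≤ 1 / η * ‖P.feas (x (m + i))‖ := by positivity
    rcases h1 with h1 | h1
    · have : 1 < 1 / ρ * ‖P.vIter S c x (m + i)‖ := by
        rw [one_div_mul_eq_div, one_lt_div hρ]
        exact not_le.1 h1
      linarith
    · have : 1 < 1 / η * ‖P.feas (x (m + i))‖ := by
        rw [one_div_mul_eq_div, one_lt_div hη]
        exact not_le.1 h1
      linarith
  have hsum := Finset.sum_lt_sum_of_nonempty (s := Finset.range (m + 1)) (by simp) hgt
  rw [Finset.sum_const, Finset.card_range, nsmul_eq_mul, mul_one, Finset.sum_add_distrib,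
    ← Finset.mul_sum, ← Finset.mul_sum] at hsum
  set V := ∑ i ∈ Finset.range (m + 1), ‖P.vIter S c x (m + i)‖
  set F := ∑ i ∈ Finset.range (m + 1), ‖P.feas (x (m + i))‖ with hF
  have hF0 : 0 ≤ F := Finset.sum_nonneg fun _ _ => norm_nonneg _
  have hn0 : (0 : ℝ) < (m : ℝ) + 1 := by positivity
  have h1 : 1 / η * (1 / ((m : ℝ) + 1) * F)
      ≤ 1 / η * Real.sqrt (c ^ 3 / ((2 * m : ℕ) : ℝ)) * (1 / ((m : ℝ) + 1) * F) := by
    apply mul_le_mul_of_nonneg_right _ (by positivity)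
    exact le_mul_of_one_le_right (by positivity) hs1
  have h2 : 1 / ((m : ℝ) + 1) * (1 / ρ * V + 1 / η * F) ≤ 1 := by
    have e1 : 1 / ((m : ℝ) + 1) * (1 / ρ * V + 1 / η * F)
        = 1 / ρ * (1 / ((m : ℝ) + 1) * V) + 1 / η * (1 / ((m : ℝ) + 1) * F) := by ring
    linarith
  rw [one_div_mul_eq_div, div_le_one hn0] at h2
  push_cast at hsum
  linarith

/-! ### The penalty threshold and the orders of the bounds. -/

namespace Assumptions

lemma coefficients_nonneg (hP : P.Assumptions W) (hS : S.Admissible B W.mMax) {R : ℝ}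
    (hR : 0 ≤ R) (cl : ℝ) :
    0 ≤ P.κ6 W S ∧ 0 ≤ P.κt1 W S cl ∧ 0 ≤ P.ξ0 W S R ∧ 0 ≤ P.κ3 W S ∧ 0 ≤ P.κt2 W S cl ∧
      0 ≤ P.ξ1 W S R := by
  have := hP.κ4_pos hS
  have := hP.κ5_nonneg
  have := hP.κ1_nonneg hS
  have := hP.deltaPhi_nonneg
  have := hS.chi_pos
  have : 0 ≤ 1 - S.θ := by linarith [hS.theta_le]
  refine ⟨?_, ?_, ?_, ?_, ?_, ?_⟩
  · unfold κ6; positivity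
  · unfold κt1; positivity
  · unfold ξ0; positivity
  · unfold κ3; positivity
  · unfold κt2; positivity
  · unfold ξ1; positivity

/-- Above the threshold, the iteration bound is at most the cube of the penalty. -/
lemma iterBound_le_cube (hP : P.Assumptions W) (hS : S.Admissible B W.mMax) {c cl R ρ η : ℝ}
    (hcl : 0 < cl) (hc : cl ≤ c) (hR : 0 ≤ R) (hρ : 0 < ρ) (hη : 0 < η)
    (hhat : P.cHat W S ρ η cl R ≤ c) : P.iterBound W S c ρ η cl R ≤ c ^ 3 := by
  have hc0 : 0 < c := hcl.trans_le hc
  obtain ⟨n6, n1, nx0, n3, n2, nx1⟩ := hP.coefficients_nonneg hS hR cl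
  set ε := min ρ η with hε
  have hε0 : 0 < ε := lt_min hρ hη
  have hTdef : P.iterBound W S cl 1 1 cl R = 48 * ((P.κ6 W S + P.κt1 W S cl)
      + (P.ξ0 W S R + P.κ3 W S + P.κt2 W S cl) * cl + P.ξ1 W S R * cl ^ 2) := by
    rw [iterBound]; ring
  have hT0 : 0 ≤ P.iterBound W S cl 1 1 cl R := by rw [hTdef]; positivity
  set T := P.iterBound W S cl 1 1 cl R with hT
  set u := c / cl with hu
  have hu1 : 1 ≤ u := by rw [hu, one_le_div hcl]; exact hc
  have hcu : c = u * cl := by rw [hu]; field_simp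
  have hρε : 1 / ρ ^ 2 ≤ 1 / ε ^ 2 :=
    one_div_le_one_div_of_le (by positivity) (pow_le_pow_left₀ hε0.le (min_le_left _ _) 2)
  have hηε : 1 / η ^ 2 ≤ 1 / ε ^ 2 :=
    one_div_le_one_div_of_le (by positivity) (pow_le_pow_left₀ hε0.le (min_le_right _ _) 2)
  have hi0 : 0 ≤ 1 / ε ^ 2 := by positivity
  -- Scaling from `cl` to `c = u * cl` with `u ≥ 1`: the terms free of tolerances grow at most like
  -- `u²`, the others at most like `u/ε²`.
  have hbound : P.iterBound W S c ρ η cl R ≤ T * u ^ 2 + T * u * (1 / ε ^ 2) := by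
    have hu2 : u ≤ u ^ 2 := by nlinarith
    have b1 : P.κ6 W S ≤ P.κ6 W S * u ^ 2 := le_mul_of_one_le_right n6 (by nlinarith)
    have b2 : P.κt1 W S cl / ρ ^ 2 ≤ P.κt1 W S cl * (u * (1 / ε ^ 2)) := by
      rw [div_eq_mul_one_div]
      apply mul_le_mul_of_nonneg_left _ n1
      nlinarith
    have b3 : P.ξ0 W S R * c ≤ P.ξ0 W S R * cl * u ^ 2 := by
      rw [hcu]
      nlinarith [mul_nonneg nx0 hcl.le]
    have b4 : P.κ3 W S / η ^ 2 * c ≤ P.κ3 W S * cl * (u * (1 / ε ^ 2)) := by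
      rw [div_eq_mul_one_div, hcu]
      have := mul_le_mul_of_nonneg_left hηε (show 0 ≤ P.κ3 W S * (u * cl) by positivity)
      linarith
    have b5 : P.κt2 W S cl / ρ ^ 2 * c ≤ P.κt2 W S cl * cl * (u * (1 / ε ^ 2)) := by
      rw [div_eq_mul_one_div, hcu]
      have := mul_le_mul_of_nonneg_left hρε (show 0 ≤ P.κt2 W S cl * (u * cl) by positivity)
      linarith
    have b6 : P.ξ1 W S R * c ^ 2 = P.ξ1 W S R * cl ^ 2 * u ^ 2 := by rw [hcu]; ring
    have p1 : 0 ≤ (P.κt1 W S cl + P.κ3 W S * cl + P.κt2 W S cl * cl) * u ^ 2 := by positivity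
    have p2 : 0 ≤ (P.κ6 W S + P.ξ0 W S R * cl + P.ξ1 W S R * cl ^ 2) * (u * (1 / ε ^ 2)) := by
      positivity
    rw [hTdef, iterBound]
    linarith
  have hhat' : T / cl ^ 2 + Real.sqrt (cl ^ 3 * T) / (cl ^ 2 * ε) ≤ c := by
    refine le_trans (le_of_eq ?_) hhat
    rw [cHat, ← hT, ← hε]
    field_simp
  set α := T / cl ^ 2 with hα
  set β := Real.sqrt (cl ^ 3 * T) / (cl ^ 2 * ε) with hβ
  have hα0 : 0 ≤ α := by positivity
  have hβ0 : 0 ≤ β := by positivity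
  have hβ2 : β ^ 2 = T / cl * (1 / ε ^ 2) := by
    rw [hβ, div_pow, Real.sq_sqrt (by positivity)]
    field_simp
  have h1 : T * u ^ 2 + T * u * (1 / ε ^ 2) = c * (c * α + β ^ 2) := by
    rw [hβ2, hα, hu]
    field_simp
  rw [h1] at hbound
  refine hbound.trans ?_
  -- The threshold says `α + β ≤ c`. In particular `β ≤ c`, so `cα + β² ≤ c(α + β) ≤ c²`.
  have h2 : c * α + β ^ 2 ≤ c ^ 2 := by nlinarith
  calc c * (c * α + β ^ 2) ≤ c * c ^ 2 := mul_le_mul_of_nonneg_left h2 hc0.le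
    _ = c ^ 3 := by ring

/-- Above the threshold the method stops successfully within the iteration bound. -/
theorem exists_stopsSuccess (hP : P.Assumptions W) (hS : S.Admissible B W.mMax) {c cl R ρ η : ℝ}
    (hcl : 0 < cl) (hc : cl ≤ c) (hR : 0 ≤ R) (hρ : 0 < ρ) (hη : 0 < η)
    {x₀ : PiLp 2 E} {p₀ : Y} (hx₀ : x₀ ∈ P.dom)
    (hp₀ : p₀ ∈ Set.range P.opA) (hp₀' : ‖p₀‖ ≤ c * R)
    {x : ℕ → PiLp 2 E} {p : ℕ → Y} (hrun : P.IsRun S c x₀ p₀ x p)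
    (hhat : P.cHat W S ρ η cl R ≤ c) :
    ∃ k : ℕ, P.StopsSuccess S ρ η c x k ∧ (k : ℝ) ≤ P.iterBound W S c ρ η cl R := by
  obtain ⟨k, hk | hk, hle⟩ := hP.exists_stops hS hcl hc hR hρ hη hx₀ hp₀ hp₀' hrun
  · exact ⟨k, hk, hle⟩
  · obtain ⟨hreach, hns, hfail⟩ := hk
    obtain ⟨i, hi1, hik, hsucc⟩ := exists_successTest_of_failTest hρ hη
      (hle.trans (hP.iterBound_le_cube hS hcl hc hR hρ hη hhat)) hfail
    rcases hik.eq_or_lt with rfl | hlt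
    · exact absurd hsucc hns
    · exact absurd hsucc (hreach.2 i hi1 hlt).1

lemma exists_iterBound_le (hP : P.Assumptions W) (hS : S.Admissible B W.mMax) {cl R : ℝ}
    (hcl : 0 < cl) (hR : 0 ≤ R) :
    ∃ C : ℝ, 0 ≤ C ∧ ∀ ρ η c : ℝ, 0 < ρ → 0 < η → cl ≤ c →
      P.iterBound W S c ρ η cl R ≤ C * (1 + (1 + 1 / ρ ^ 2 + 1 / η ^ 2) * c + c ^ 2) := by
  obtain ⟨n6, n1, nx0, n3, n2, nx1⟩ := hP.coefficients_nonneg hS hR cl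
  set A := P.κ6 W S + P.κt1 W S cl / cl + P.ξ0 W S R + P.κ3 W S + P.κt2 W S cl + P.ξ1 W S R
    with hA
  have n1' : 0 ≤ P.κt1 W S cl / cl := by positivity
  have hA0 : 0 ≤ A := by positivity
  -- The term `κ̃⁽¹⁾/ρ²` carries no factor `c`; `c ≥ cl` supplies one, which is why `A` contains
  -- `κ̃⁽¹⁾/cl`. The `2` is needed because two summands are charged to `c/ρ²`.
  refine ⟨48 * (2 * A), by positivity, ?_⟩
  intro ρ η c hρ hη hc
  have hc0 : 0 < c := hcl.trans_le hc
  have hr : 0 ≤ 1 / ρ ^ 2 * c := by positivity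
  have he : 0 ≤ 1 / η ^ 2 * c := by positivity
  have b1 : P.κ6 W S ≤ A := by linarith
  have b2 : P.κt1 W S cl / ρ ^ 2 ≤ A * (1 / ρ ^ 2 * c) := by
    have e1 : P.κt1 W S cl / ρ ^ 2 = P.κt1 W S cl / cl * (1 / ρ ^ 2 * cl) := by
      field_simp
    rw [e1]
    have e2 : 1 / ρ ^ 2 * cl ≤ 1 / ρ ^ 2 * c := mul_le_mul_of_nonneg_left hc (by positivity)
    exact mul_le_mul (by linarith) e2 (by positivity) hA0
  have b3 : P.ξ0 W S R * c ≤ A * c := mul_le_mul_of_nonneg_right (by linarith) hc0.le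
  have b4 : P.κ3 W S / η ^ 2 * c ≤ A * (1 / η ^ 2 * c) := by
    rw [div_eq_mul_one_div, mul_assoc]
    exact mul_le_mul_of_nonneg_right (by linarith) he
  have b5 : P.κt2 W S cl / ρ ^ 2 * c ≤ A * (1 / ρ ^ 2 * c) := by
    rw [div_eq_mul_one_div, mul_assoc]
    exact mul_le_mul_of_nonneg_right (by linarith) hr
  have b6 : P.ξ1 W S R * c ^ 2 ≤ A * c ^ 2 :=
    mul_le_mul_of_nonneg_right (by linarith) (by positivity)
  have p1 := mul_nonneg hA0 hc0.le
  have p2 := mul_nonneg hA0 (sq_nonneg c)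
  have p3 := mul_nonneg hA0 he
  rw [iterBound]
  nlinarith

lemma exists_cHat_le (hP : P.Assumptions W) (hS : S.Admissible B W.mMax) {cl R : ℝ}
    (hcl : 0 < cl) (hR : 0 ≤ R) :
    ∃ C : ℝ, ∀ ρ η : ℝ, 0 < ρ → 0 < η → min ρ η ≤ 1 → P.cHat W S ρ η cl R ≤ C / min ρ η := by
  have hT := hP.le_iterBound hS cl hcl hR one_pos one_pos
  refine ⟨1 / cl ^ 2 * (P.iterBound W S cl 1 1 cl R
    + Real.sqrt (cl ^ 3 * P.iterBound W S cl 1 1 cl R)), ?_⟩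
  intro ρ η hρ hη hε1
  have hε0 : 0 < min ρ η := lt_min hρ hη
  rw [cHat, mul_div_assoc, add_div]
  apply mul_le_mul_of_nonneg_left _ (by positivity)
  have : P.iterBound W S cl 1 1 cl R ≤ P.iterBound W S cl 1 1 cl R / min ρ η := by
    rw [le_div_iff₀ hε0]
    exact mul_le_of_le_one_right (by linarith) hε1
  linarith

lemma exists_complexity (hP : P.Assumptions W) (hS : S.Admissible B W.mMax) {cl R : ℝ}
    (hcl : 0 < cl) (hR : 0 ≤ R) (K : ℝ) :
    ∃ C : ℝ, ∀ ρ η c : ℝ, 0 < ρ → 0 < η → min ρ η ≤ 1 → cl ≤ c → c ≤ K / min ρ η →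
      P.iterBound W S c ρ η cl R ≤ C / min ρ η ^ 3 := by
  obtain ⟨C, hC0, hC⟩ := hP.exists_iterBound_le hS hcl hR
  refine ⟨C * (1 + 3 * K + K ^ 2), ?_⟩
  intro ρ η c hρ hη hε1 hc hcK
  have hc0 : 0 < c := hcl.trans_le hc
  refine (hC ρ η c hρ hη hc).trans ?_
  set ε := min ρ η with hε
  have hε0 : 0 < ε := lt_min hρ hη
  rw [mul_div_assoc]
  apply mul_le_mul_of_nonneg_left _ hC0
  have hcε : c * ε ≤ K := (le_div_iff₀ hε0).1 hcK
  -- Positivity of `K` is forced by `0 < c ≤ K/ε`; for other `K` the claim is vacuous.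
  have hK0 : 0 < K := lt_of_lt_of_le (by positivity) hcε
  have hρε : 1 / ρ ^ 2 ≤ 1 / ε ^ 2 :=
    one_div_le_one_div_of_le (by positivity) (pow_le_pow_left₀ hε0.le (min_le_left _ _) 2)
  have hηε : 1 / η ^ 2 ≤ 1 / ε ^ 2 :=
    one_div_le_one_div_of_le (by positivity) (pow_le_pow_left₀ hε0.le (min_le_right _ _) 2)
  have hε2 : ε ^ 2 ≤ 1 := pow_le_one₀ hε0.le hε1
  have hε3 : ε ^ 3 ≤ 1 := pow_le_one₀ hε0.le hε1
  have h1ε : 1 ≤ 1 / ε ^ 2 := by rw [one_le_div (by positivity)]; exact hε2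
  have h1 : (1 + 1 / ρ ^ 2 + 1 / η ^ 2) * c ≤ 3 * K / ε ^ 3 := by
    have e1 : (1 + 1 / ρ ^ 2 + 1 / η ^ 2) * c ≤ 3 * (1 / ε ^ 2) * c :=
      mul_le_mul_of_nonneg_right (by linarith) hc0.le
    have e2 : 3 * (1 / ε ^ 2) * c ≤ 3 * (1 / ε ^ 2) * (K / ε) :=
      mul_le_mul_of_nonneg_left hcK (by positivity)
    have e3 : 3 * (1 / ε ^ 2) * (K / ε) = 3 * K / ε ^ 3 := by field_simp
    linarith
  have h2 : 1 ≤ 1 / ε ^ 3 := by rw [one_le_div (by positivity)]; exact hε3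
  -- This term is only of order `ε⁻²`; the cubic order comes from `c` multiplied by the inverse
  -- squared tolerances.
  have h3 : c ^ 2 ≤ K ^ 2 / ε ^ 3 := by
    rw [le_div_iff₀ (by positivity)]
    have e1 : (c * ε) ^ 2 ≤ K ^ 2 := pow_le_pow_left₀ (by positivity) hcε 2
    have e2 : c ^ 2 * ε ^ 3 = (c * ε) ^ 2 * ε := by ring
    rw [e2]
    exact (mul_le_of_le_one_right (sq_nonneg _) hε1).trans e1
  rw [add_div, add_div]
  linarith

end Assumptions

end Problem

end DPADMM

end

theorem proposition2p1 {B : ℕ} {E : Fin B → Type*} {Y : Type*}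
    [∀ t, NormedAddCommGroup (E t)] [∀ t, InnerProductSpace ℝ (E t)]
    [∀ t, FiniteDimensional ℝ (E t)]
    [NormedAddCommGroup Y] [InnerProductSpace ℝ Y] [FiniteDimensional ℝ Y]
    (P : DPADMM.Problem E Y) (W : DPADMM.Moduli E) (hP : P.Assumptions W)
    (S : DPADMM.Params) (hS : S.Admissible B W.mMax)
    (R cl : ℝ) (hR : 0 ≤ R) (hcl : 0 < cl) :
    -- the call with tolerances `ρ, η`, penalty `c` and starting point `(x₀, p₀)`
    (∀ (ρ η c : ℝ) (x₀ : PiLp 2 E) (p₀ : Y), 0 < ρ → 0 < η →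
      x₀ ∈ P.dom → p₀ ∈ Set.range P.opA → ‖p₀‖ ≤ c * R → cl ≤ c →
      -- the iterates are well defined
      (∃! s : (ℕ → PiLp 2 E) × (ℕ → Y), P.IsRun S c x₀ p₀ s.1 s.2) ∧
      ∀ (x : ℕ → PiLp 2 E) (p : ℕ → Y), P.IsRun S c x₀ p₀ x p →
        -- (a)
        (∃ k : ℕ, (P.StopsSuccess S ρ η c x k ∨ P.StopsFail S ρ η c x k) ∧
          (k : ℝ) ≤ P.iterBound W S c ρ η cl R) ∧
        -- (b)
        (∀ k : ℕ, P.StopsSuccess S ρ η c x k →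
          P.IsStationaryPair ρ η (x k) (P.qIter S c x p k)) ∧
        -- (c)
        (P.cHat W S ρ η cl R ≤ c → ∃ k : ℕ, P.StopsSuccess S ρ η c x k)) ∧
    -- order of the iteration bound in (a)
    (∃ C : ℝ, ∀ ρ η c : ℝ, 0 < ρ → 0 < η → cl ≤ c →
      P.iterBound W S c ρ η cl R
        ≤ C * (1 + (1 + 1 / ρ ^ 2 + 1 / η ^ 2) * c + c ^ 2)) ∧
    -- order of the threshold in (c)
    (∃ C : ℝ, ∀ ρ η : ℝ, 0 < ρ → 0 < η → min ρ η ≤ 1 →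
      P.cHat W S ρ η cl R ≤ C / min ρ η) ∧
    -- complexity with a fixed penalty above the threshold and of the order of the threshold
    (∀ K : ℝ, ∃ C : ℝ, ∀ (ρ η c : ℝ) (x₀ : PiLp 2 E) (p₀ : Y), 0 < ρ → 0 < η → min ρ η ≤ 1 →
      x₀ ∈ P.dom → p₀ ∈ Set.range P.opA → ‖p₀‖ ≤ c * R → cl ≤ c →
      P.cHat W S ρ η cl R ≤ c → c ≤ K / min ρ η →
      ∀ (x : ℕ → PiLp 2 E) (p : ℕ → Y), P.IsRun S c x₀ p₀ x p →
        ∃ k : ℕ, P.StopsSuccess S ρ η c x k ∧ (k : ℝ) ≤ C / min ρ η ^ 3 ∧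
          P.IsStationaryPair ρ η (x k) (P.qIter S c x p k)) := by
  refine ⟨?_, ?_, hP.exists_cHat_le hS hcl hR, ?_⟩
  · intro ρ η c x₀ p₀ hρ hη hx₀ hp₀ hp₀' hc
    refine ⟨hP.existsUnique_run hS (hcl.le.trans hc) hx₀ p₀, ?_⟩
    intro x p hrun
    refine ⟨hP.exists_stops hS hcl hc hR hρ hη hx₀ hp₀ hp₀' hrun, ?_, ?_⟩
    · intro k hk
      exact hP.isStationaryPair_of_stopsSuccess hS hx₀ hrun hk
    · intro hhat
      obtain ⟨k, hk, -⟩ := hP.exists_stopsSuccess hS hcl hc hR hρ hη hx₀ hp₀ hp₀' hrun hhat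
      exact ⟨k, hk⟩
  · obtain ⟨C, -, hC⟩ := hP.exists_iterBound_le hS hcl hR
    exact ⟨C, hC⟩
  · intro K
    obtain ⟨C, hC⟩ := hP.exists_complexity hS hcl hR K
    refine ⟨C, ?_⟩
    intro ρ η c x₀ p₀ hρ hη hε1 hx₀ hp₀ hp₀' hc hhat hcK x p hrun
    obtain ⟨k, hk, hle⟩ := hP.exists_stopsSuccess hS hcl hc hR hρ hη hx₀ hp₀ hp₀' hrun hhat
    exact ⟨k, hk, hle.trans (hC ρ η c hρ hη hε1 hc hcK),
      hP.isStationaryPair_of_stopsSuccess hS hx₀ hrun hk⟩
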